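/- Let $d\ge 2$ and let $\mathcal F$ be the Fourier transform on $\mathcal S'(\mathbb R^d)$, normalized on $\mathcal S(\mathbb R^d)$ by $\mathcal F g(\xi)=(2\pi)^{-d/2}\int_{\mathbb R^d} e^{-ix\cdot\xi}g(x)\,dx$. Let $\phi_0\in\mathcal S(\mathbb R^d)$ be non-negative with $\phi_0(x)=1$ for $|x|\le 1$ and $\phi_0(x)=0$ for $|x|\ge \frac32$, and put $\phi_j(x)=\phi_0(2^{-j}x)-\phi_0(2^{-j+1}x)$ for $j\ge1$. Let $\varphi_0\in C_0^\infty(\mathbb R)$ with $\varphi_0=1$ on $[-1,1]$ and $\operatorname{supp}\varphi_0\subset[-\frac32,\frac32]$, put $\varphi_j(\xi)=\varphi_0(2^{-j}\xi)-\varphi_0(2^{-j+1}\xi)$ for $j\ge 1$, and $\varphi_{\bar k}(x)=\varphi_{k_1}(x_1)\cdots\varphi_{k_d}(x_d)$ for $\bar k\in\mathbb N_0^d$. For $0<p<\infty$, $0<q\le\infty$ and $t\in\mathbb R$ let $F^t_{p,q}(\mathbb R^d)$ and $S^t_{p,q}F(\mathbb R^d)$ be the spaces of all $f\in\mathcal S'(\mathbb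 R^d)$ for which, respectively, $$\|f|F^t_{p,q}\|=\Big\|\Big(\sum_{j=0}^\infty 2^{jtq}\,|\mathcal F^{-1}[\phi_j\mathcal F f]|^q\Big)^{1/q}\Big|L_p(\mathbb R^d)\Big\|,\qquad \|f|S^t_{p,q}F\|=\Big\|\Big(\sum_{\bar k\in\mathbb N_0^d}2^{|\bar k|_1tq}\,|\mathcal F^{-1}[\varphi_{\bar k}\mathcal F f]|^q\Big)^{1/q}\Big|L_p(\mathbb R^d)\Big\|$$ is finite (with the supremum in place of the sum if $q=\infty$), where $|\bar k|_1=k_1+\dots+k_d$. Write $X\hookrightarrow Y$ if $X\subset Y$ and there is a constant $C$ with $\|f|Y\|\le C\,\|f|X\|$ for all $f\in X$. Theorem 3.6. Let $0<p<\infty$, $0<q\le\infty$ and $t\in\mathbb R$. Then, for all $0<p_0<\infty$, $0<q_0\le\infty$ and $t_0\in\mathbb R$, $$S^{t_0}_{p_0,q_0}F(\mathbb R^d)\hookrightarrow F^t_{p,q}(\mathbb R^d)\quad\Longrightarrow\quad S^{t_0}_{p_0,q_0}F(\mathbb R^d)\hookrightarrow S^t_{p,q}F(\mathbb R^d).$$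 In this sense no space $S^{t_0}_{p_0,q_0}F(\mathbb R^d)$ embedded into $F^t_{p,q}(\mathbb R^d)$ is larger than $S^t_{p,q}F(\mathbb R^d)$. -/

import Mathlib

open scoped ENNReal NNReal SchwartzMap FourierTransform ComplexOrder

noncomputable section

namespace MixedTL

section Multipliers

variable {E : Type*} [NormedAddCommGroup E] [NormedSpace ℝ E]

/-- The dilated function `x ↦ m (c • x)`, for a unit `c` of `ℝ`. -/
def dilate (c : ℝˣ) (m : 𝓢(E, ℂ)) : 𝓢(E, ℂ) :=
  SchwartzMap.compCLMOfContinuousLinearEquiv ℂ (ContinuousLinearEquiv.smulLeft c : E ≃L[ℝ] E) m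

theorem dilate_apply (c : ℝˣ) (m : 𝓢(E, ℂ)) (x : E) : dilate c m x = m ((c : ℝ) • x) := rfl

/-- The number `2 ^ (-j)` as a unit of `ℝ`. -/
def invTwoPow (j : ℕ) : ℝˣ := Units.mk0 ((2 : ℝ)⁻¹ ^ j) (by positivity)

/-- The dyadic system generated by `φ₀`: its member number `0` is `φ₀`, and its member number
`j ≥ 1` is `x ↦ φ₀ (2 ^ (-j) x) - φ₀ (2 ^ (-j + 1) x)`. -/
def dyadic (φ₀ : 𝓢(E, ℂ)) : ℕ → 𝓢(E, ℂ)
  | 0 => φ₀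
  | j + 1 => dilate (invTwoPow (j + 1)) φ₀ - dilate (invTwoPow j) φ₀

theorem hasCompactSupport_dilate (c : ℝˣ) {m : 𝓢(E, ℂ)} (hm : HasCompactSupport m) :
    HasCompactSupport (dilate c m) :=
  hm.comp_homeomorph (ContinuousLinearEquiv.smulLeft c : E ≃L[ℝ] E).toHomeomorph

theorem hasCompactSupport_dyadic {φ₀ : 𝓢(E, ℂ)} (h : HasCompactSupport φ₀) (j : ℕ) :
    HasCompactSupport (dyadic φ₀ j) := by
  cases j with
  | zero => exact h
  | succ j => exact (hasCompactSupport_dilate _ h).sub (hasCompactSupport_dilate _ h)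

end Multipliers

section FrequencyPiece

variable {E : Type*} [NormedAddCommGroup E] [InnerProductSpace ℝ E] [FiniteDimensional ℝ E]
  [MeasurableSpace E] [BorelSpace E]

/-- The number `2π` as a unit of `ℝ`. -/
def twoPi : ℝˣ := Units.mk0 (2 * Real.pi) (by positivity)

/-- The function `F⁻¹[m F f]`, for a Schwartz function `m` and a tempered distribution `f`, where
`F` is the Fourier transform with kernel `(2π)^(-d/2) exp (-i ⟨x, ξ⟩)`. As a function it is the
convolution of `f` with the Schwartz function `z ↦ (2π)^(-d) ∫ exp (i ⟨z, ξ⟩) m ξ dξ`, i.e. its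
value at `x` is `f` applied to
`y ↦ (2π)^(-d) ∫ exp (i ⟨x - y, ξ⟩) m ξ dξ = ∫ exp (-2πi ⟨y - x, ξ⟩) m (2π ξ) dξ`,
which is the translate by `x` of Mathlib's Fourier transform of `m (2π ·)`. -/
def freqPiece (m : 𝓢(E, ℂ)) (f : 𝓢'(E, ℂ)) (x : E) : ℂ :=
  f (SchwartzMap.compSubConstCLM ℂ x (𝓕 (dilate twoPi m)))

end FrequencyPiece

section Norms

/-- The `ℓ_q` quasi-norm, `0 < q ≤ ∞`, of a family of elements of `[0, ∞]`. -/
def lqNorm {ι : Type*} (q : ℝ≥0∞) (a : ι → ℝ≥0∞) : ℝ≥0∞ :=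
  if q = ∞ then ⨆ k, a k else (∑' k, a k ^ q.toReal) ^ (1 / q.toReal)

variable {d : ℕ}

/-- Generators of smooth dyadic decompositions of unity on `ℝ^d` made of annuli. -/
structure IsoGenerator (d : ℕ) where
  /-- the generating function -/
  fn : 𝓢(EuclideanSpace ℝ (Fin d), ℂ)
  nonneg : ∀ x, 0 ≤ fn x
  eq_one : ∀ x, ‖x‖ ≤ 1 → fn x = 1
  eq_zero : ∀ x, 3 / 2 ≤ ‖x‖ → fn x = 0

/-- Generators of smooth dyadic decompositions of unity on the real line. -/
structure LineGenerator where
  /-- the generating function -/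
  fn : 𝓢(ℝ, ℂ)
  eq_one : ∀ ξ ∈ Set.Icc (-1 : ℝ) 1, fn ξ = 1
  tsupport_subset : tsupport fn ⊆ Set.Icc (-(3 / 2) : ℝ) (3 / 2)

theorem LineGenerator.hasCompactSupport (φ : LineGenerator) : HasCompactSupport φ.fn :=
  isCompact_Icc.of_isClosed_subset (isClosed_tsupport _) φ.tsupport_subset

theorem hasCompactSupport_prod {g : Fin d → 𝓢(ℝ, ℂ)} (hg : ∀ i, HasCompactSupport (g i)) :
    HasCompactSupport (fun x : EuclideanSpace ℝ (Fin d) => ∏ i, g i (x i)) := by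
  have hK : IsCompact ((EuclideanSpace.equiv (Fin d) ℝ).toHomeomorph ⁻¹'
      Set.pi Set.univ fun i => tsupport (g i)) :=
    (Homeomorph.isCompact_preimage _).2 (isCompact_univ_pi hg)
  refine HasCompactSupport.intro hK fun x hx => ?_
  by_contra h
  refine hx fun i _ => subset_tsupport _ fun h0 => h (Finset.prod_eq_zero (Finset.mem_univ i) h0)

theorem contDiff_tensor (g : Fin d → 𝓢(ℝ, ℂ)) :
    ContDiff ℝ (⊤ : ℕ∞) (fun x : EuclideanSpace ℝ (Fin d) => ∏ i, g i (x i)) :=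
  contDiff_prod fun i _ => ((g i).smooth ⊤).comp (g := g i)
    (f := fun x : EuclideanSpace ℝ (Fin d) => x i) (by fun_prop)

/-- The tensor product `x ↦ φ_{k_1} (x_1) ⋯ φ_{k_d} (x_d)` of members of the dyadic system
generated by `φ` on the line. -/
def tensorDyadic (φ : LineGenerator) (k : Fin d → ℕ) : 𝓢(EuclideanSpace ℝ (Fin d), ℂ) :=
  (hasCompactSupport_prod
    fun i => hasCompactSupport_dyadic φ.hasCompactSupport (k i)).toSchwartzMap
    (contDiff_tensor fun i => dyadic φ.fn (k i))

/-- The quasi-norm of the isotropic Lizorkin-Triebel space `F^t_{p,q}(ℝ^d)`, with value `∞` at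
the tempered distributions outside this space. -/
def isoNorm (φ : IsoGenerator d) (t : ℝ) (p q : ℝ≥0∞)
    (f : 𝓢'(EuclideanSpace ℝ (Fin d), ℂ)) : ℝ≥0∞ :=
  MeasureTheory.eLpNorm (fun x => lqNorm q fun j : ℕ =>
    ENNReal.ofReal ((2 : ℝ) ^ (t * j)) * ‖freqPiece (dyadic φ.fn j) f x‖ₑ) p
    MeasureTheory.volume

/-- The quasi-norm of the Lizorkin-Triebel space of dominating mixed smoothness
`S^t_{p,q}F(ℝ^d)`, with value `∞` at the tempered distributions outside this space. -/
def mixedNorm (φ : LineGenerator) (t : ℝ) (p q : ℝ≥0∞)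
    (f : 𝓢'(EuclideanSpace ℝ (Fin d), ℂ)) : ℝ≥0∞ :=
  MeasureTheory.eLpNorm (fun x => lqNorm q fun k : Fin d → ℕ =>
    ENNReal.ofReal ((2 : ℝ) ^ (t * ((∑ i, k i : ℕ) : ℝ))) *
      ‖freqPiece (tensorDyadic φ k) f x‖ₑ) p
    MeasureTheory.volume

/-- The continuous embedding `X ↪ Y` of the spaces of all tempered distributions with finite
quasi-norm `NX` and `NY`, respectively. -/
def Embeds (NX NY : 𝓢'(EuclideanSpace ℝ (Fin d), ℂ) → ℝ≥0∞) : Prop :=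
  (∀ f, NX f < ∞ → NY f < ∞) ∧ ∃ C : ℝ≥0, ∀ f, NX f < ∞ → NY f ≤ C * NX f

end Norms

end MixedTL

end

/-! The assumed embedding enters only through three inequalities between the parameters, and these
already suffice for the conclusion.

Necessity. For frequencies close to one coordinate axis and away from the overlaps of the dyadic
pieces (`IsLevel`), both decompositions act alike: a single block survives, the `j`-th annulus on
one side and the multi-index `j` times a unit vector on the other, and it reproduces the function.
Both quasi-norms of such test functions are therefore explicit. Stretching one coordinate
(`exists_stretch_bound`) gives `p₀ ≤ p` when done at frequency level 0, and `t - 1/p ≤ t₀ - 1/p₀`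
when it moves the function to level `n`. If `p₀ = p` and `t₀ = t`, a sum of modulated copies of one
function over many levels gives `q₀ ≤ q` (`index_le_of_embeds`).

Sufficiency. If `p₀ = p` and `t₀ = t`, monotonicity of the `ℓ_q` norms is enough. Otherwise `p₀ < p`
or `t < t₀`, and an embedding of Jawerth type holds whatever `q₀` and `q` are
(`exists_mixedNorm_le`). It rests on two facts. By Poisson summation, a band-limited function is an
absolutely convergent combination of its samples on any shift of a lattice (`hasSum_sampling`),
which yields a Nikol'skii inequality (`SamplingBound.le_lpInt`). In one variable the weighted blocks
at a point then lie below one increasing and one decreasing geometric sequence, so that their sum is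
a geometric mean of the two constants (`tsum_le_of_le_min`); integration gives the estimate.
Sampling bounds survive sums, suprema and partial `L_p` norms, so induction on the number of
variables gives the mixed case. -/

noncomputable section

namespace MixedTL

open MeasureTheory

/-! ### The `L_p` functional on nonnegative functions -/

section LpInt

variable {α : Type*} [MeasurableSpace α]

/-- The `L_p` functional of a `[0, ∞]`-valued function. -/
def lpInt (p : ℝ) (μ : Measure α) (F : α → ℝ≥0∞) : ℝ≥0∞ := (∫⁻ x, F x ^ p ∂μ) ^ (1 / p)

variable {p : ℝ} {μ : Measure α} {F G : α → ℝ≥0∞}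

theorem lpInt_mono (hp : 0 < p) (h : ∀ x, F x ≤ G x) : lpInt p μ F ≤ lpInt p μ G :=
  ENNReal.rpow_le_rpow (lintegral_mono fun x => ENNReal.rpow_le_rpow (h x) hp.le) (by positivity)

theorem lpInt_rpow (hp : 0 < p) : lpInt p μ F ^ p = ∫⁻ x, F x ^ p ∂μ := by
  rw [lpInt, ← ENNReal.rpow_mul, one_div_mul_cancel hp.ne', ENNReal.rpow_one]

theorem lpInt_const_mul (hp : 0 < p) (c : ℝ≥0∞) (hF : Measurable F) :
    lpInt p μ (fun x => c * F x) = c * lpInt p μ F := by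
  simp only [lpInt, ENNReal.mul_rpow_of_nonneg _ _ hp.le]
  rw [lintegral_const_mul _ (hF.pow_const p), ENNReal.mul_rpow_of_nonneg _ _ (by positivity),
    ← ENNReal.rpow_mul, mul_one_div_cancel hp.ne', ENNReal.rpow_one]

theorem lpInt_rpow_left {r : ℝ} (hr : 0 < r) :
    lpInt (p / r) μ (fun x => F x ^ r) = lpInt p μ F ^ r := by
  simp only [lpInt, ← ENNReal.rpow_mul]
  congr 1
  · congr 1; ext x; congr 1; field_simp
  · field_simp

theorem lpInt_sum_le {ι : Type*} (hp : 1 ≤ p) (s : Finset ι) {F : ι → α → ℝ≥0∞}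
    (hF : ∀ i, Measurable (F i)) :
    lpInt p μ (fun x => ∑ i ∈ s, F i x) ≤ ∑ i ∈ s, lpInt p μ (F i) := by
  classical
  have hp0 : 0 < p := by linarith
  induction s using Finset.induction_on with
  | empty => simp [lpInt, hp0]
  | insert i s hi ih =>
    simp only [Finset.sum_insert hi]
    refine le_trans ?_ (add_le_add le_rfl ih)
    exact ENNReal.lintegral_Lp_add_le (hF i).aemeasurable
      (Finset.measurable_fun_sum s fun j _ => hF j).aemeasurable hp

theorem ENNReal_iSup_rpow {ι : Sort*} (hp : 0 < p) (f : ι → ℝ≥0∞) :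
    (⨆ i, f i) ^ p = ⨆ i, f i ^ p :=
  (ENNReal.orderIsoRpow p hp).map_iSup f

/-- Minkowski's inequality for countable sums of nonnegative functions. -/
theorem lpInt_tsum_le {ι : Type*} [Countable ι] (hp : 1 ≤ p) {F : ι → α → ℝ≥0∞}
    (hF : ∀ i, Measurable (F i)) :
    lpInt p μ (fun x => ∑' i, F i x) ≤ ∑' i, lpInt p μ (F i) := by
  have hp0 : 0 < p := by linarith
  have key : lpInt p μ (fun x => ∑' i, F i x) =
      ⨆ s : Finset ι, lpInt p μ (fun x => ∑ i ∈ s, F i x) := by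
    simp only [lpInt, ENNReal.tsum_eq_iSup_sum, ENNReal_iSup_rpow hp0]
    rw [lintegral_iSup_directed, ENNReal_iSup_rpow (by positivity)]
    · exact fun s => ((Finset.measurable_fun_sum s fun j _ => hF j).pow_const p).aemeasurable
    · exact Monotone.directed_le fun s t hst x =>
        ENNReal.rpow_le_rpow (Finset.sum_le_sum_of_subset hst) hp0.le
  rw [key]
  exact iSup_le fun s => (lpInt_sum_le hp s hF).trans (ENNReal.sum_le_tsum s)

end LpInt

/-! ### Sums of dyadic minima -/

theorem two_rpow_add (a b : ℝ) : (2 : ℝ≥0∞) ^ (a + b) = 2 ^ a * 2 ^ b :=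
  ENNReal.rpow_add _ _ two_ne_zero ENNReal.ofNat_ne_top

theorem ofReal_two_rpow (a : ℝ) : ENNReal.ofReal ((2 : ℝ) ^ a) = 2 ^ a := by
  rw [← ENNReal.ofReal_rpow_of_pos two_pos, ENNReal.ofReal_ofNat]

theorem exists_two_rpow_eq {u : ℝ≥0∞} (hu0 : u ≠ 0) (hu : u ≠ ∞) :
    ∃ x : ℝ, (2 : ℝ≥0∞) ^ x = u := by
  refine ⟨Real.logb 2 u.toReal, ?_⟩
  rw [← ofReal_two_rpow, Real.rpow_logb two_pos (by norm_num) (ENNReal.toReal_pos hu0 hu),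
    ENNReal.ofReal_toReal hu]

theorem two_rpow_ne_top (a : ℝ) : (2 : ℝ≥0∞) ^ a ≠ ∞ := by simp

theorem two_rpow_mono {a b : ℝ} (h : a ≤ b) : (2 : ℝ≥0∞) ^ a ≤ 2 ^ b :=
  ENNReal.rpow_le_rpow_of_exponent_le one_le_two h

theorem tsum_two_rpow_neg_ne_top {γ : ℝ} (hγ : 0 < γ) : ∑' j : ℕ, (2 : ℝ≥0∞) ^ (-(γ * j)) ≠ ∞ := by
  have h : ∀ j : ℕ, (2 : ℝ≥0∞) ^ (-(γ * j)) = ((2 : ℝ≥0∞) ^ (-γ)) ^ j := fun j => by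
    rw [← ENNReal.rpow_natCast, ← ENNReal.rpow_mul, neg_mul]
  simp_rw [h, ENNReal.tsum_geometric]
  rw [ENNReal.inv_ne_top]
  refine (tsub_pos_of_lt ?_).ne'
  exact ENNReal.rpow_lt_one_of_one_lt_of_neg (by norm_num) (by linarith)

/-- The profile `2 ^ (α i)` for `i ≤ 0` and `2 ^ (-β (i - 1))` for `i > 0`. -/
def dyadicProfile (α β : ℝ) (i : ℤ) : ℝ≥0∞ :=
  if i ≤ 0 then 2 ^ (α * i) else 2 ^ (-(β * (i - 1)))

theorem tsum_dyadicProfile_ne_top {α β : ℝ} (hα : 0 < α) (hβ : 0 < β) :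
    ∑' i : ℤ, dyadicProfile α β i ≠ ∞ := by
  have h := tsum_of_nat_of_neg_add_one (f := dyadicProfile α β) ENNReal.summable ENNReal.summable
  rw [h, tsum_eq_zero_add' ENNReal.summable]
  refine ENNReal.add_ne_top.2 ⟨ENNReal.add_ne_top.2 ⟨?_, ?_⟩, ?_⟩
  · simp [dyadicProfile]
  · convert tsum_two_rpow_neg_ne_top hβ using 4 with j
    rw [dyadicProfile, if_neg (by push_cast; omega)]
    push_cast
    ring_nf
  · refine ne_top_of_le_ne_top (tsum_two_rpow_neg_ne_top hα) (ENNReal.tsum_le_tsum fun j => ?_)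
    rw [dyadicProfile, if_pos (by omega)]
    refine two_rpow_mono ?_
    push_cast
    nlinarith

/-- The increasing and the decreasing bound cross at a real index `K`, where both equal the stated
geometric mean. On either side of `K` the smaller one decays geometrically, so the sum is at most
that value times a constant independent of `u` and `v`. -/
theorem tsum_le_of_le_min {α β : ℝ} (hα : 0 < α) (hβ : 0 < β) {u v : ℝ≥0∞} {b : ℕ → ℝ≥0∞}
    (hu : ∀ j : ℕ, b j ≤ u * 2 ^ (α * j)) (hv : ∀ j : ℕ, b j ≤ v * 2 ^ (-(β * j))) :
    ∑' j, b j ≤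
      (∑' i : ℤ, dyadicProfile α β i) * (u ^ (β / (α + β)) * v ^ (α / (α + β))) := by
  have hαβ : 0 < α + β := by linarith
  have hC : ∑' i : ℤ, dyadicProfile α β i ≠ 0 := by
    intro h
    simpa [dyadicProfile] using ENNReal.tsum_eq_zero.1 h 0
  rcases eq_or_ne u 0 with rfl | hu0
  · simp only [zero_mul, nonpos_iff_eq_zero] at hu; simp [hu]
  rcases eq_or_ne v 0 with rfl | hv0
  · simp only [zero_mul, nonpos_iff_eq_zero] at hv; simp [hv]
  rcases eq_or_ne u ∞ with rfl | hu1
  · rw [ENNReal.top_rpow_of_pos (by positivity), ENNReal.top_mul, ENNReal.mul_top hC]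
    · exact le_top
    · simp [ENNReal.rpow_eq_zero_iff, hv0]; intros; positivity
  rcases eq_or_ne v ∞ with rfl | hv1
  · rw [ENNReal.top_rpow_of_pos (by positivity), ENNReal.mul_top, ENNReal.mul_top hC]
    · exact le_top
    · simp [ENNReal.rpow_eq_zero_iff, hu0, hu1]
  obtain ⟨x, rfl⟩ := exists_two_rpow_eq hu0 hu1
  obtain ⟨y, rfl⟩ := exists_two_rpow_eq hv0 hv1
  set K : ℝ := (y - x) / (α + β) with hK
  set w : ℝ := x * (β / (α + β)) + y * (α / (α + β)) with hw
  have hxw : x = w - α * K := by rw [hw, hK]; field_simp; ring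
  have hyw : y = w + β * K := by rw [hw, hK]; field_simp; ring
  have hwe : ((2 : ℝ≥0∞) ^ x) ^ (β / (α + β)) * ((2 : ℝ≥0∞) ^ y) ^ (α / (α + β)) = 2 ^ w := by
    rw [← ENNReal.rpow_mul, ← ENNReal.rpow_mul, ← two_rpow_add]
  rw [hwe]
  -- The profile is centred at `⌊K⌋`. The left branch uses `⌊K⌋ ≤ K`, the right one `K < ⌊K⌋ + 1`,
  -- which accounts for the unit shift in the profile.
  have hb : ∀ j : ℕ, b j ≤ dyadicProfile α β ((j : ℤ) - ⌊K⌋) * 2 ^ w := by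
    intro j
    have h1 := Int.floor_le K
    have h2 := Int.lt_floor_add_one K
    rw [dyadicProfile]
    split_ifs with hj
    · refine (hu j).trans ?_
      rw [← two_rpow_add, ← two_rpow_add]
      refine two_rpow_mono ?_
      rw [hxw]; push_cast
      nlinarith
    · refine (hv j).trans ?_
      rw [← two_rpow_add, ← two_rpow_add]
      refine two_rpow_mono ?_
      rw [hyw]; push_cast
      nlinarith
  calc ∑' j, b j ≤ ∑' j : ℕ, dyadicProfile α β ((j : ℤ) - ⌊K⌋) * 2 ^ w := ENNReal.tsum_le_tsum hb
    _ = (∑' j : ℕ, dyadicProfile α β ((j : ℤ) - ⌊K⌋)) * 2 ^ w := ENNReal.tsum_mul_right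
    _ ≤ _ := by
      gcongr
      exact ENNReal.tsum_comp_le_tsum_of_injective (f := fun j : ℕ => (j : ℤ) - ⌊K⌋)
        (fun a b h => by simpa using h) _

/-! ### Functions controlled by their samples -/

/-- `H` is dominated at each point by weighted sums of its samples along every shift of the
lattice of step `h`. -/
def SamplingBound (κ : ℤ → ℝ≥0∞) (h : ℝ) (H : ℝ → ℝ≥0∞) : Prop :=
  ∀ x, ∀ θ ∈ Set.Icc (0 : ℝ) 1, H x ≤ ∑' n : ℤ, κ n * H (x + (n + θ) * h)

theorem lintegral_comp_affine {h : ℝ} (hh : 0 < h) (c : ℝ) {F : ℝ → ℝ≥0∞} (hF : Measurable F) :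
    ∫⁻ θ, F (c + θ * h) = ENNReal.ofReal h⁻¹ * ∫⁻ x, F x := by
  have h1 : ∫⁻ θ, F (c + θ * h) = ∫⁻ y, F (c + y) ∂(Measure.map (fun x => x * h) volume) := by
    rw [lintegral_map (by fun_prop) (by fun_prop)]
  rw [h1, Real.map_volume_mul_right hh.ne', lintegral_smul_measure, lintegral_add_left_eq_self,
    abs_of_pos (inv_pos.2 hh), smul_eq_mul]

/-- Nikol'skii's inequality: take the `L_p` norm over the shift `θ ∈ [0, 1]` and apply Minkowski.
Each sample, as a function of `θ`, has norm at most `h ^ (-1/p)` times the norm of `H` by a change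
of variables. -/
theorem SamplingBound.le_lpInt {κ : ℤ → ℝ≥0∞} {h : ℝ} {H : ℝ → ℝ≥0∞} (hH : SamplingBound κ h H)
    (hm : Measurable H) (hh : 0 < h) {p : ℝ} (hp : 1 ≤ p) (x : ℝ) :
    H x ≤ (∑' n, κ n) * (ENNReal.ofReal h⁻¹ ^ (1 / p) * lpInt p volume H) := by
  have hp0 : 0 < p := by linarith
  set μ := (volume : Measure ℝ).restrict (Set.Icc 0 1) with hμ
  have e : H x = lpInt p μ (fun _ => H x) := by
    simp only [lpInt, lintegral_const, hμ, Measure.restrict_apply_univ, Real.volume_Icc]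
    simp [← ENNReal.rpow_mul, hp0.ne']
  have hmeas : ∀ n : ℤ, Measurable fun θ : ℝ => H (x + (n + θ) * h) := fun n => by fun_prop
  have hmeas' : ∀ n : ℤ, Measurable fun θ : ℝ => κ n * H (x + (n + θ) * h) := fun n => by fun_prop
  calc H x = lpInt p μ (fun _ => H x) := e
    _ ≤ lpInt p μ (fun θ => ∑' n : ℤ, κ n * H (x + (n + θ) * h)) := by
        refine ENNReal.rpow_le_rpow (setLIntegral_mono' measurableSet_Icc fun θ hθ => ?_)
          (by positivity)
        exact ENNReal.rpow_le_rpow (hH x θ hθ) hp0.le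
    _ ≤ ∑' n : ℤ, lpInt p μ (fun θ => κ n * H (x + (n + θ) * h)) := lpInt_tsum_le hp hmeas'
    _ ≤ ∑' n : ℤ, κ n * (ENNReal.ofReal h⁻¹ ^ (1 / p) * lpInt p volume H) := by
        refine ENNReal.tsum_le_tsum fun n => ?_
        rw [lpInt_const_mul hp0 _ (hmeas n)]
        gcongr
        rw [lpInt, lpInt, ← ENNReal.mul_rpow_of_nonneg _ _ (by positivity)]
        refine ENNReal.rpow_le_rpow ?_ (by positivity)
        refine (setLIntegral_le_lintegral _ _).trans ?_
        rw [← lintegral_comp_affine hh (x + n * h) (hm.pow_const p)]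
        simp only [add_mul, add_assoc, le_refl]
    _ = _ := ENNReal.tsum_mul_right

/-- A one-dimensional embedding of Jawerth type for sequences of functions controlled by their
samples. -/
theorem exists_lpInt_tsum_le_lpInt_iSup {p₀ p s₀ s : ℝ} (hp₀ : 1 ≤ p₀) (hp : p₀ ≤ p)
    (hs : s - 1 / p ≤ s₀ - 1 / p₀) (hlt : p₀ < p ∨ s < s₀) {κ : ℤ → ℝ≥0∞} (hκ : ∑' n, κ n ≠ ∞) :
    ∃ C : ℝ≥0∞, C ≠ ∞ ∧ ∀ h : ℕ → ℝ → ℝ≥0∞, (∀ j, Measurable (h j)) →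
      (∀ j, SamplingBound κ ((2 : ℝ)⁻¹ ^ j) (h j)) →
      lpInt p volume (fun x => ∑' j : ℕ, 2 ^ (s * j) * h j x) ≤
        C * lpInt p₀ volume (fun x => ⨆ j : ℕ, 2 ^ (s₀ * j) * h j x) := by
  have hp₀' : 0 < p₀ := by linarith
  have hp' : 0 < p := by linarith
  rcases hp.lt_or_eq with hlt' | rfl
  swap
  -- For `p₀ = p` the gain in smoothness is strict, and a geometric series suffices pointwise.
  · have hss : 0 < s₀ - s := by
      rcases hlt with h | h
      · exact absurd h (lt_irrefl _)
      · linarith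
    refine ⟨_, tsum_two_rpow_neg_ne_top hss, fun h hm _ => ?_⟩
    rw [← lpInt_const_mul hp' _ (.iSup fun j => (hm j).const_mul _)]
    refine lpInt_mono hp' fun x => ?_
    rw [← ENNReal.tsum_mul_right]
    refine ENNReal.tsum_le_tsum fun j => ?_
    calc (2 : ℝ≥0∞) ^ (s * j) * h j x = 2 ^ (-((s₀ - s) * j)) * (2 ^ (s₀ * j) * h j x) := by
          rw [← mul_assoc, ← two_rpow_add]; ring_nf
      _ ≤ _ := by gcongr; exact le_iSup (fun j : ℕ => 2 ^ (s₀ * j) * h j x) j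
  -- The Nikol'skii bound grows with rate `s - s₀ + 1/p₀ ≤ α`, the bound by `G` with rate `s - s₀ ≤
  -- -β`. The resulting power of `G` is `θ = p₀ / p`, exactly what turns an `L_p` norm into a power
  -- of the `L_{p₀}` norm.
  set α := 1 / p with hα
  set β := 1 / p₀ - 1 / p with hβ
  have hα0 : 0 < α := by positivity
  have hβ0 : 0 < β := sub_pos.2 (one_div_lt_one_div_of_lt hp₀' hlt')
  have hαβ : α + β = 1 / p₀ := by rw [hα, hβ]; ring
  set D := ∑' i : ℤ, dyadicProfile α β i with hD
  have hDt : D ≠ ∞ := tsum_dyadicProfile_ne_top hα0 hβ0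
  set θ := α / (α + β) with hθ
  set θ' := β / (α + β) with hθ'
  have hθp : θ * p = p₀ := by rw [hθ, hαβ, hα]; field_simp
  have hθ0 : 0 < θ := by positivity
  have hθ'0 : 0 < θ' := by positivity
  have hθθ' : θ' + θ = 1 := by rw [hθ, hθ']; field_simp; ring
  refine ⟨D * (∑' n, κ n) ^ θ', ENNReal.mul_ne_top hDt (by simp [hθ'0.le, hκ]),
    fun h hm hS => ?_⟩
  set G : ℝ → ℝ≥0∞ := fun x => ⨆ j : ℕ, 2 ^ (s₀ * j) * h j x with hG
  have hGm : Measurable G := .iSup fun j => (hm j).const_mul _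
  set A := lpInt p₀ volume G with hA
  have hle : ∀ (j : ℕ) (x : ℝ), 2 ^ (s₀ * j) * h j x ≤ G x := fun j x =>
    le_iSup (fun j : ℕ => 2 ^ (s₀ * j) * h j x) j
  have hhA : ∀ j : ℕ, lpInt p₀ volume (h j) ≤ 2 ^ (-(s₀ * j)) * A := fun j => by
    rw [hA, ← lpInt_const_mul hp₀' _ hGm]
    refine lpInt_mono hp₀' fun x => ?_
    calc h j x = 2 ^ (-(s₀ * j)) * (2 ^ (s₀ * j) * h j x) := by
          rw [← mul_assoc, ← two_rpow_add]; simp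
      _ ≤ _ := by gcongr; exact hle j x
  have hu : ∀ (x : ℝ) (j : ℕ), 2 ^ (s * j) * h j x ≤ ((∑' n, κ n) * A) * 2 ^ (α * j) := by
    intro x j
    have h1 := (hS j).le_lpInt (hm j) (by positivity) hp₀ x
    have h2 : ENNReal.ofReal (((2 : ℝ)⁻¹ ^ j)⁻¹) ^ (1 / p₀) = 2 ^ (1 / p₀ * j) := by
      rw [inv_pow, inv_inv, ENNReal.ofReal_pow (by norm_num), ENNReal.ofReal_ofNat,
        ← ENNReal.rpow_natCast, ← ENNReal.rpow_mul, mul_comm]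
    rw [h2] at h1
    calc 2 ^ (s * j) * h j x
        ≤ 2 ^ (s * j) * ((∑' n, κ n) * (2 ^ (1 / p₀ * j) * (2 ^ (-(s₀ * j)) * A))) := by
          gcongr; exact h1.trans (by gcongr; exact hhA j)
      _ = ((∑' n, κ n) * A) * 2 ^ (s * j + (1 / p₀ * j + -(s₀ * j))) := by
          rw [two_rpow_add, two_rpow_add]; ring
      _ ≤ _ := by
          gcongr
          · exact one_le_two
          · have : (0 : ℝ) ≤ j := by positivity
            rw [hα]; nlinarith
  have hv : ∀ (x : ℝ) (j : ℕ), 2 ^ (s * j) * h j x ≤ G x * 2 ^ (-(β * j)) := by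
    intro x j
    calc 2 ^ (s * j) * h j x = (2 ^ (s₀ * j) * h j x) * 2 ^ ((s - s₀) * j) := by
          rw [mul_right_comm, ← two_rpow_add]; ring_nf
      _ ≤ _ := by
          gcongr
          · exact hle j x
          · exact one_le_two
          · have : (0 : ℝ) ≤ j := by positivity
            rw [hβ]; nlinarith
  have hpt : ∀ x, ∑' j : ℕ, 2 ^ (s * j) * h j x ≤
      (D * ((∑' n, κ n) * A) ^ θ') * G x ^ θ := fun x => by
    rw [mul_assoc]; exact tsum_le_of_le_min hα0 hβ0 (hu x) (hv x)
  refine (lpInt_mono hp' hpt).trans ?_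
  rw [lpInt_const_mul hp' _ (hGm.pow_const θ), ENNReal.mul_rpow_of_nonneg _ _ hθ'0.le]
  have hGA : lpInt p volume (fun x => G x ^ θ) = A ^ θ := by
    have := lpInt_rpow_left (p := p₀) (μ := volume) (F := G) hθ0
    rwa [show p₀ / θ = p by rw [← hθp]; field_simp] at this
  rw [hGA, mul_assoc, mul_assoc, mul_assoc, ← ENNReal.rpow_add_of_nonneg _ _ hθ'0.le hθ0.le, hθθ',
    ENNReal.rpow_one]

/-! ### The embedding for families indexed by `ℕ ^ n` -/

theorem lintegral_fin_succ {n : ℕ} {F : (Fin (n + 1) → ℝ) → ℝ≥0∞} (hF : Measurable F) :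
    ∫⁻ x, F x = ∫⁻ y : ℝ, ∫⁻ z : Fin n → ℝ, F (Fin.cons y z) := by
  have h := (volume_preserving_piFinSuccAbove (fun _ : Fin (n + 1) => ℝ) 0).symm
  rw [← h.lintegral_comp hF, Measure.volume_eq_prod, lintegral_prod]
  · simp only [MeasurableEquiv.piFinSuccAbove_symm_apply, Fin.insertNthEquiv, Equiv.coe_fn_mk,
      Fin.insertNth_zero']
  · exact (hF.comp (MeasurableEquiv.measurable _)).aemeasurable

theorem measurable_fin_cons {n : ℕ} :
    Measurable fun z : ℝ × (Fin n → ℝ) => (Fin.cons z.1 z.2 : Fin (n + 1) → ℝ) := by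
  refine measurable_pi_lambda _ fun i => ?_
  refine Fin.cases ?_ (fun i => ?_) i
  · simpa using measurable_fst
  · simpa [Function.comp_def] using (measurable_pi_apply i).comp measurable_snd

theorem tsum_fin_succ {n : ℕ} (g : (Fin (n + 1) → ℕ) → ℝ≥0∞) :
    ∑' k, g k = ∑' (j : ℕ) (l : Fin n → ℕ), g (Fin.cons j l) := by
  rw [← ENNReal.tsum_prod, ← (Fin.consEquiv fun _ : Fin (n + 1) => ℕ).tsum_eq]
  rfl

theorem SamplingBound.const_mul {κ : ℤ → ℝ≥0∞} {h : ℝ} {H : ℝ → ℝ≥0∞} (hH : SamplingBound κ h H)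
    (c : ℝ≥0∞) : SamplingBound κ h (fun x => c * H x) := fun x θ hθ => by
  simp only [mul_left_comm _ c, ENNReal.tsum_mul_left]
  gcongr
  exact hH x θ hθ

theorem SamplingBound.iSup {ι : Sort*} {κ : ℤ → ℝ≥0∞} {h : ℝ} {H : ι → ℝ → ℝ≥0∞}
    (hH : ∀ i, SamplingBound κ h (H i)) : SamplingBound κ h (fun x => ⨆ i, H i x) :=
  fun x θ hθ => iSup_le fun i => (hH i x θ hθ).trans <| by
    gcongr
    exact le_iSup (fun i => H i _) i

theorem SamplingBound.tsum {ι : Type*} {κ : ℤ → ℝ≥0∞} {h : ℝ} {H : ι → ℝ → ℝ≥0∞}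
    (hH : ∀ i, SamplingBound κ h (H i)) : SamplingBound κ h (fun x => ∑' i, H i x) :=
  fun x θ hθ => by
    simp only [← ENNReal.tsum_mul_left]
    rw [ENNReal.tsum_comm]
    exact ENNReal.tsum_le_tsum fun i => hH i x θ hθ

/-- Minkowski's inequality in the parameter `z`. It makes the one-variable estimate applicable to
functions already integrated in the other variables. -/
theorem SamplingBound.lpInt {α : Type*} [MeasurableSpace α] {μ : Measure α} {κ : ℤ → ℝ≥0∞} {h : ℝ}
    {H : α → ℝ → ℝ≥0∞} (hH : ∀ z, SamplingBound κ h (H z)) (hm : ∀ x, Measurable fun z => H z x)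
    {p : ℝ} (hp : 1 ≤ p) : SamplingBound κ h (fun x => lpInt p μ fun z => H z x) :=
  fun x θ hθ => by
    have hp0 : 0 < p := by linarith
    calc MixedTL.lpInt p μ (fun z => H z x)
        ≤ MixedTL.lpInt p μ (fun z => ∑' n : ℤ, κ n * H z (x + (n + θ) * h)) :=
          lpInt_mono hp0 fun z => hH z x θ hθ
      _ ≤ ∑' n : ℤ, MixedTL.lpInt p μ (fun z => κ n * H z (x + (n + θ) * h)) :=
          lpInt_tsum_le hp fun n => (hm _).const_mul _
      _ = _ := by
          congr 1; ext n
          rw [lpInt_const_mul hp0 _ (hm _)]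

/-- Induction on the number of variables. Minkowski takes the sum over the first index out of the
inner `L_p` norm; the partial norms `H j` keep a sampling bound in the first variable, so the
one-variable estimate applies to them; the inductive hypothesis handles the remaining variables. -/
theorem exists_lpInt_tsum_le_lpInt_iSup_pi {p₀ p s₀ s : ℝ} (hp₀ : 1 ≤ p₀) (hp : p₀ ≤ p)
    (hs : s - 1 / p ≤ s₀ - 1 / p₀) (hlt : p₀ < p ∨ s < s₀) {κ : ℤ → ℝ≥0∞} (hκ : ∑' n, κ n ≠ ∞)
    (n : ℕ) :
    ∃ C : ℝ≥0∞, C ≠ ∞ ∧ ∀ a : (Fin n → ℕ) → (Fin n → ℝ) → ℝ≥0∞, (∀ k, Measurable (a k)) →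
      (∀ k i x, SamplingBound κ ((2 : ℝ)⁻¹ ^ k i) (fun y => a k (Function.update x i y))) →
      lpInt p volume (fun x => ∑' k, 2 ^ (s * ((∑ i, k i : ℕ) : ℝ)) * a k x) ≤
        C * lpInt p₀ volume (fun x => ⨆ k, 2 ^ (s₀ * ((∑ i, k i : ℕ) : ℝ)) * a k x) := by
  have hp₀' : 0 < p₀ := by linarith
  have hp' : 0 < p := by linarith
  have hp1 : 1 ≤ p := by linarith
  induction n with
  | zero =>
    refine ⟨1, ENNReal.one_ne_top, fun a _ _ => ?_⟩
    have hv : (volume : Measure (Fin 0 → ℝ)) = Measure.dirac (fun i => i.elim0) :=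
      Measure.volume_pi_eq_dirac _
    rw [lpInt, lpInt, hv, lintegral_dirac, lintegral_dirac]
    simp [tsum_fintype, ← ENNReal.rpow_mul, hp₀'.ne', hp'.ne']
  | succ n ih =>
    obtain ⟨C₁, hC₁, h₁⟩ := ih
    obtain ⟨C₂, hC₂, h₂⟩ := exists_lpInt_tsum_le_lpInt_iSup hp₀ hp hs hlt hκ
    refine ⟨C₂ * C₁, ENNReal.mul_ne_top hC₂ hC₁, fun a ha hS => ?_⟩
    have hac : ∀ k, Measurable fun z : ℝ × (Fin n → ℝ) => a k (Fin.cons z.1 z.2) :=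
      fun k => (ha k).comp measurable_fin_cons
    have hac' : ∀ k y, Measurable fun z : Fin n → ℝ => a k (Fin.cons y z) :=
      fun k y => (hac k).comp measurable_prodMk_left
    set G : (Fin (n + 1) → ℝ) → ℝ≥0∞ :=
      fun x => ⨆ k, 2 ^ (s₀ * ((∑ i, k i : ℕ) : ℝ)) * a k x with hG
    have hGm : Measurable G := .iSup fun k => (ha k).const_mul _
    set b : ℕ → ℝ → (Fin n → ℝ) → ℝ≥0∞ := fun j y z =>
      ∑' l : Fin n → ℕ, 2 ^ (s * ((∑ i, l i : ℕ) : ℝ)) * a (Fin.cons j l) (Fin.cons y z) with hb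
    have hbm : ∀ j, Measurable fun z : ℝ × (Fin n → ℝ) => b j z.1 z.2 := fun j =>
      .tsum fun l => (hac _).const_mul _
    have hbm' : ∀ j y, Measurable (b j y) := fun j y => (hbm j).comp measurable_prodMk_left
    set H : ℕ → ℝ → ℝ≥0∞ := fun j y => lpInt p volume (b j y) with hH
    have hHm : ∀ j, Measurable (H j) := fun j =>
      (Measurable.lintegral_prod_right' ((hbm j).pow_const p)).pow_const _
    have hHS : ∀ j, SamplingBound κ ((2 : ℝ)⁻¹ ^ j) (H j) := fun j =>
      .lpInt (H := fun z y => b j y z) (fun z => .tsum fun l => .const_mul (by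
        have := hS (Fin.cons j l) 0 (Fin.cons 0 z)
        simpa only [Fin.cons_zero, Fin.update_cons_zero] using this) _) (fun y => hbm' j y) hp1
    have hsup : ∀ y, ⨆ j : ℕ, 2 ^ (s₀ * j) * H j y ≤
        C₁ * lpInt p₀ volume (fun z => G (Fin.cons y z)) := by
      intro y
      -- Taking the supremum over `j` before applying the inductive hypothesis gives a bound for all
      -- `j` at once. The sampling steps in the remaining variables depend on `l` only, so the
      -- supremum keeps the sampling bounds.
      set c : (Fin n → ℕ) → (Fin n → ℝ) → ℝ≥0∞ := fun l z =>
        ⨆ j : ℕ, 2 ^ (s₀ * j) * a (Fin.cons j l) (Fin.cons y z) with hc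
      have h3 := h₁ c (fun l => .iSup fun j => (hac' _ y).const_mul _) (fun l i z =>
        .iSup fun j => .const_mul (by
          have := hS (Fin.cons j l) i.succ (Fin.cons y z)
          simpa only [Fin.cons_succ, ← Fin.cons_update] using this) _)
      refine iSup_le fun j => ?_
      rw [hH, ← lpInt_const_mul hp' _ (hbm' j y)]
      refine (lpInt_mono hp' fun z => ?_).trans
        (h3.trans (mul_le_mul_right (lpInt_mono hp₀' fun z => ?_) _))
      · rw [hb, ← ENNReal.tsum_mul_left]
        refine ENNReal.tsum_le_tsum fun l => ?_
        rw [mul_left_comm]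
        gcongr
        exact le_iSup (fun j : ℕ => 2 ^ (s₀ * j) * a (Fin.cons j l) (Fin.cons y z)) j
      · refine iSup_le fun l => ?_
        rw [hc, ENNReal.mul_iSup]
        refine iSup_le fun j => ?_
        refine le_trans (le_of_eq ?_) (le_iSup (fun k =>
          2 ^ (s₀ * ((∑ i, k i : ℕ) : ℝ)) * a k (Fin.cons y z)) (Fin.cons j l))
        rw [← mul_assoc, ← two_rpow_add, Fin.sum_univ_succ]
        simp only [Fin.cons_zero, Fin.cons_succ]
        push_cast
        ring_nf
    have hfub : ∀ {r : ℝ} (hr : 0 < r) {F : (Fin (n + 1) → ℝ) → ℝ≥0∞} (hF : Measurable F),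
        lpInt r volume F = lpInt r volume fun y => lpInt r volume fun z => F (Fin.cons y z) := by
      intro r hr F hF
      conv_rhs => rw [lpInt]
      simp only [lpInt_rpow hr]
      rw [lpInt, lintegral_fin_succ (hF.pow_const r)]
    have hLm : Measurable fun x => ∑' k, 2 ^ (s * ((∑ i, k i : ℕ) : ℝ)) * a k x :=
      .tsum fun k => (ha k).const_mul _
    rw [hfub hp' hLm, hfub hp₀' hGm]
    calc lpInt p volume (fun y => lpInt p volume fun z =>
          ∑' k, 2 ^ (s * ((∑ i, k i : ℕ) : ℝ)) * a k (Fin.cons y z))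
        ≤ lpInt p volume (fun y => ∑' j : ℕ, 2 ^ (s * j) * H j y) := by
          refine lpInt_mono hp' fun y => ?_
          refine le_trans (le_of_eq ?_) ((lpInt_tsum_le hp1 (μ := volume) (F := fun (j : ℕ) z =>
            2 ^ (s * j) * b j y z) fun j => (hbm' j y).const_mul _).trans (le_of_eq ?_))
          · congr 1; ext z
            rw [tsum_fin_succ]
            congr 1; ext j
            rw [hb, ← ENNReal.tsum_mul_left]
            congr 1; ext l
            rw [← mul_assoc, ← two_rpow_add, Fin.sum_univ_succ]
            simp only [Fin.cons_zero, Fin.cons_succ]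
            push_cast
            ring_nf
          · congr 1; ext j
            rw [lpInt_const_mul hp' _ (hbm' j y)]
      _ ≤ C₂ * lpInt p₀ volume (fun y => ⨆ j : ℕ, 2 ^ (s₀ * j) * H j y) := h₂ H hHm hHS
      _ ≤ C₂ * lpInt p₀ volume (fun y => C₁ * lpInt p₀ volume fun z => G (Fin.cons y z)) := by
          gcongr; exact lpInt_mono hp₀' hsup
      _ = _ := by
          rw [lpInt_const_mul hp₀', mul_assoc]
          exact (Measurable.lintegral_prod_right'
            ((hGm.comp measurable_fin_cons).pow_const p₀)).pow_const _

/-! ### Series and translations in the Schwartz space -/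

section Schwartz

variable {E : Type*} [NormedAddCommGroup E] [NormedSpace ℝ E]

/-- An absolutely convergent series of Schwartz functions converges to its pointwise sum, if this
is a Schwartz function. -/
theorem hasSum_schwartz {ι : Type*} {u : ι → 𝓢(E, ℂ)} {v : 𝓢(E, ℂ)}
    (hs : ∀ k l, Summable fun i => SchwartzMap.seminorm ℂ k l (u i))
    (hv : ∀ x, HasSum (fun i => u i x) (v x)) : HasSum u v := by
  rw [HasSum, SummationFilter.unconditional_filter,
    (schwartz_withSeminorms ℂ E ℂ).tendsto_nhds]
  rintro ⟨k, l⟩ ε hε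
  have htail := tendsto_tsum_compl_atTop_zero (fun i => SchwartzMap.seminorm ℂ k l (u i))
  filter_upwards [htail.eventually (gt_mem_nhds hε)] with s hs'
  refine lt_of_le_of_lt ?_ hs'
  -- Differentiation term by term expresses the derivatives of the error as tails, whose weighted
  -- norms are at most the tails of the series of seminorms.
  have hderiv : iteratedFDeriv ℝ l v = fun x => ∑' i, iteratedFDeriv ℝ l (u i) x := by
    rw [← iteratedFDeriv_tsum (N := ⊤) (v := fun l i => SchwartzMap.seminorm ℂ 0 l (u i))
      (fun i => (u i).smooth _) (fun l _ => hs 0 l)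
      (fun l i x _ => (u i).norm_iteratedFDeriv_le_seminorm ℂ l x) le_top]
    congr 1
    ext x
    exact (hv x).tsum_eq.symm
  refine SchwartzMap.seminorm_le_bound ℂ k l _ (tsum_nonneg fun _ => apply_nonneg _ _) fun x => ?_
  have hsum : Summable fun i => iteratedFDeriv ℝ l (u i) x :=
    .of_norm_bounded (hs 0 l) fun i => (u i).norm_iteratedFDeriv_le_seminorm ℂ l x
  have e : iteratedFDeriv ℝ l (∑ i ∈ s, u i - v) x =
      -∑' i : {i // i ∉ s}, iteratedFDeriv ℝ l (u i) x := by
    have h1 : (⇑(∑ i ∈ s, u i - v) : E → ℂ) = (fun x => ∑ i ∈ s, u i x) - ⇑v := by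
      ext y; simp
    rw [h1, iteratedFDeriv_sub_apply, congrFun hderiv x, ← hsum.sum_add_tsum_subtype_compl s,
      iteratedFDeriv_fun_sum_apply]
    · abel
    · exact fun i _ => ((u i).smooth _).contDiffAt
    · exact (ContDiff.sum fun i _ => (u i).smooth _).contDiffAt
    · exact (v.smooth _).contDiffAt
  rw [e, norm_neg]
  have hs1 : Summable fun i : {i // i ∉ s} => SchwartzMap.seminorm ℂ k l (u i) :=
    (hs k l).subtype _
  have hb : ∀ i, ‖x‖ ^ k * ‖iteratedFDeriv ℝ l (u i) x‖ ≤ SchwartzMap.seminorm ℂ k l (u i) :=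
    fun i => (u i).le_seminorm ℂ k l x
  calc ‖x‖ ^ k * ‖∑' i : {i // i ∉ s}, iteratedFDeriv ℝ l (u i) x‖
      = ‖∑' i : {i // i ∉ s}, ‖x‖ ^ k • iteratedFDeriv ℝ l (u i) x‖ := by
        rw [tsum_const_smul'', norm_smul, Real.norm_of_nonneg (by positivity)]
    _ ≤ ∑' i : {i // i ∉ s}, SchwartzMap.seminorm ℂ k l (u i) :=
        tsum_of_norm_bounded hs1.hasSum fun i => by
          rw [norm_smul, Real.norm_of_nonneg (by positivity)]; exact hb i

/-- Follows from `‖x‖ ≤ (1 + ‖x - v‖) (1 + ‖v‖)`. Growth in the shift is only polynomial, so the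
rapidly decaying sampling coefficients outweigh it. -/
theorem seminorm_compSubConst_le (ψ : 𝓢(E, ℂ)) (k l : ℕ) :
    ∃ C : ℝ, 0 ≤ C ∧ ∀ v : E,
      SchwartzMap.seminorm ℂ k l (SchwartzMap.compSubConstCLM ℂ v ψ) ≤ C * (1 + ‖v‖) ^ k := by
  refine ⟨2 ^ k * (Finset.Iic (k, l)).sup (fun m => SchwartzMap.seminorm ℂ m.1 m.2) ψ,
    by positivity, fun v => ?_⟩
  refine SchwartzMap.seminorm_le_bound ℂ k l _ (by positivity) fun x => ?_
  have e : iteratedFDeriv ℝ l (SchwartzMap.compSubConstCLM ℂ v ψ) x =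
      iteratedFDeriv ℝ l ψ (x - v) := iteratedFDeriv_comp_sub l v x
  have h1 := SchwartzMap.one_add_le_sup_seminorm_apply (𝕜 := ℂ) (m := (k, l)) le_rfl le_rfl ψ (x - v)
  have h2 : ‖x‖ ≤ (1 + ‖x - v‖) * (1 + ‖v‖) := by
    have := norm_add_le (x - v) v
    rw [sub_add_cancel] at this
    nlinarith [norm_nonneg (x - v), norm_nonneg v]
  rw [e]
  calc ‖x‖ ^ k * ‖iteratedFDeriv ℝ l ψ (x - v)‖
      ≤ ((1 + ‖x - v‖) * (1 + ‖v‖)) ^ k * ‖iteratedFDeriv ℝ l ψ (x - v)‖ := by gcongr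
    _ = ((1 + ‖x - v‖) ^ k * ‖iteratedFDeriv ℝ l ψ (x - v)‖) * (1 + ‖v‖) ^ k := by
        rw [mul_pow]; ring
    _ ≤ _ := by gcongr

theorem continuous_seminorm_compSubConst_le (ψ : 𝓢(E, ℂ)) (q : Seminorm ℂ 𝓢(E, ℂ))
    (hq : Continuous q) :
    ∃ (C : ℝ) (N : ℕ), ∀ v : E, q (SchwartzMap.compSubConstCLM ℂ v ψ) ≤ C * (1 + ‖v‖) ^ N := by
  obtain ⟨s, c, -, hc⟩ := Seminorm.bound_of_continuous (schwartz_withSeminorms ℂ E ℂ) q hq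
  choose C hC0 hC using fun m : ℕ × ℕ => seminorm_compSubConst_le ψ m.1 m.2
  refine ⟨c * ∑ m ∈ s, C m, s.sup Prod.fst, fun v => ?_⟩
  have h1 := Seminorm.le_def.1 hc (SchwartzMap.compSubConstCLM ℂ v ψ)
  have hN : ∀ m ∈ s, (1 + ‖v‖) ^ m.1 ≤ (1 + ‖v‖) ^ s.sup Prod.fst := fun m hm =>
    pow_le_pow_right₀ (by linarith [norm_nonneg v]) (Finset.le_sup (f := Prod.fst) hm)
  have h3 : (s.sup (schwartzSeminormFamily ℂ E ℂ)) (SchwartzMap.compSubConstCLM ℂ v ψ) ≤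
      (∑ m ∈ s, C m) * (1 + ‖v‖) ^ s.sup Prod.fst := by
    have h0 : 0 ≤ ∑ m ∈ s, C m := Finset.sum_nonneg fun m _ => hC0 m
    refine Seminorm.finset_sup_apply_le (by positivity) fun m hm => (hC m v).trans ?_
    exact mul_le_mul (Finset.single_le_sum (fun m _ => hC0 m) hm) (hN m hm) (by positivity) h0
  rw [mul_assoc]
  exact h1.trans (mul_le_mul_of_nonneg_left h3 c.2)

/-- The mean value inequality makes translation locally Lipschitz in every seminorm, at the cost of
one more derivative. This yields continuity, hence measurability, of the frequency pieces. -/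
theorem continuous_compSubConst (ψ : 𝓢(E, ℂ)) :
    Continuous fun v : E => SchwartzMap.compSubConstCLM ℂ v ψ := by
  rw [continuous_iff_continuousAt]
  intro v₀
  rw [ContinuousAt, (schwartz_withSeminorms ℂ E ℂ).tendsto_nhds]
  rintro ⟨k, l⟩ ε hε
  obtain ⟨C, hC0, hC⟩ := seminorm_compSubConst_le ψ k (l + 1)
  set R := C * (1 + (‖v₀‖ + 1)) ^ k with hR
  have hlip : ∀ v, ‖v - v₀‖ ≤ 1 → SchwartzMap.seminorm ℂ k l
      (SchwartzMap.compSubConstCLM ℂ v ψ - SchwartzMap.compSubConstCLM ℂ v₀ ψ) ≤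
      R * ‖v - v₀‖ := by
    intro v hv
    refine SchwartzMap.seminorm_le_bound ℂ k l _ (by positivity) fun x => ?_
    have e : iteratedFDeriv ℝ l
        (⇑(SchwartzMap.compSubConstCLM ℂ v ψ - SchwartzMap.compSubConstCLM ℂ v₀ ψ)) x =
        iteratedFDeriv ℝ l ψ (x - v) - iteratedFDeriv ℝ l ψ (x - v₀) := by
      rw [FunLike.coe_sub, iteratedFDeriv_sub_apply (SchwartzMap.smooth _ _).contDiffAt
        (SchwartzMap.smooth _ _).contDiffAt]
      congr 1
      · exact iteratedFDeriv_comp_sub l v x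
      · exact iteratedFDeriv_comp_sub l v₀ x
    rcases (pow_nonneg (norm_nonneg x) k).eq_or_lt with hx | hx
    · rw [← hx, zero_mul]; positivity
    have hdiff : Differentiable ℝ (iteratedFDeriv ℝ l ψ) :=
      (ψ.smooth ⊤).differentiable_iteratedFDeriv (by exact_mod_cast WithTop.coe_lt_top l)
    -- The derivative of `ψ` at `y` is that of its translate by `x - y` at `x`, and `‖x - y‖ ≤ ‖v₀‖
    -- + 1`.
    have hb : ∀ y ∈ Metric.closedBall (x - v₀) 1,
        ‖fderiv ℝ (iteratedFDeriv ℝ l ψ) y‖ ≤ R / ‖x‖ ^ k := by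
      intro y hy
      rw [norm_fderiv_iteratedFDeriv, le_div_iff₀' hx]
      have h1 := (SchwartzMap.compSubConstCLM ℂ (x - y) ψ).le_seminorm ℂ k (l + 1) x
      have h2 : iteratedFDeriv ℝ (l + 1) (SchwartzMap.compSubConstCLM ℂ (x - y) ψ) x =
          iteratedFDeriv ℝ (l + 1) ψ y := by
        have := iteratedFDeriv_comp_sub (𝕜 := ℝ) (f := ψ) (l + 1) (x - y) x
        rwa [sub_sub_cancel] at this
      rw [h2] at h1
      refine h1.trans ((hC _).trans ?_)
      rw [hR]
      gcongr
      rw [mem_closedBall_iff_norm] at hy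
      have h3 : x - y = v₀ - (y - (x - v₀)) := by abel
      rw [h3]
      exact (norm_sub_le _ _).trans (by linarith)
    have hmv := (convex_closedBall (x - v₀) (1 : ℝ)).norm_image_sub_le_of_norm_fderiv_le (𝕜 := ℝ)
      (fun y _ => hdiff y) hb (Metric.mem_closedBall_self zero_le_one) (y := x - v) (by
        rw [mem_closedBall_iff_norm, sub_sub_sub_cancel_left, norm_sub_rev]; exact hv)
    rw [sub_sub_sub_cancel_left, norm_sub_rev v₀] at hmv
    rw [e]
    calc _ ≤ ‖x‖ ^ k * (R / ‖x‖ ^ k * ‖v - v₀‖) := by gcongr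
      _ = _ := by field_simp
  have ht : Filter.Tendsto (fun v => R * ‖v - v₀‖) (nhds v₀) (nhds 0) := by
    have : Continuous fun v => R * ‖v - v₀‖ := by fun_prop
    simpa using this.tendsto v₀
  filter_upwards [ht.eventually (gt_mem_nhds hε), Metric.closedBall_mem_nhds v₀ one_pos]
    with v h1 h2
  exact (hlip v (by rwa [mem_closedBall_iff_norm] at h2)).trans_lt h1

end Schwartz

section Modulation

variable {E : Type*} [NormedAddCommGroup E] [InnerProductSpace ℝ E] [FiniteDimensional ℝ E]
  [MeasurableSpace E] [BorelSpace E]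

/-- The product of `m` with the character `ξ ↦ exp (2πi ⟨v, ξ⟩)`. -/
def modulate (v : E) (m : 𝓢(E, ℂ)) : 𝓢(E, ℂ) := 𝓕⁻ (SchwartzMap.compSubConstCLM ℂ v (𝓕 m))

theorem fourier_modulate (v : E) (m : 𝓢(E, ℂ)) :
    𝓕 (modulate v m) = SchwartzMap.compSubConstCLM ℂ v (𝓕 m) := by
  simp [modulate]

theorem modulate_apply (v : E) (m : 𝓢(E, ℂ)) (ξ : E) :
    modulate v m ξ = Complex.exp (↑(2 * Real.pi * inner ℝ v ξ) * Complex.I) * m ξ := by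
  have h : m ξ = (𝓕⁻ (𝓕 m)) ξ := by simp
  rw [h, modulate, SchwartzMap.fourierInv_coe, SchwartzMap.fourierInv_coe, Real.fourierInv_eq',
    Real.fourierInv_eq', ← integral_const_mul, ← integral_add_right_eq_self _ v]
  congr 1
  ext y
  simp only [SchwartzMap.compSubConstCLM_apply, add_sub_cancel_right, smul_eq_mul, ← mul_assoc,
    ← Complex.exp_add, inner_add_left]
  congr 2
  push_cast
  ring

theorem continuous_freqPiece (m : 𝓢(E, ℂ)) (f : 𝓢'(E, ℂ)) : Continuous (freqPiece m f) :=
  (map_continuous f).comp (continuous_compSubConst _)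

end Modulation

/-! ### Sampling of band-limited functions -/

section Sampling

theorem exists_schwartz_bump {E : Type*} [NormedAddCommGroup E] [InnerProductSpace ℝ E]
    [FiniteDimensional ℝ E] (c : E) {r R : ℝ} (hr : 0 < r) (hR : r < R) :
    ∃ ζ : 𝓢(E, ℂ), (∀ x, ‖x - c‖ ≤ r → ζ x = 1) ∧ ∀ x, R ≤ ‖x - c‖ → ζ x = 0 := by
  let b : ContDiffBump c := ⟨r, R, hr, hR⟩
  have hsm : ContDiff ℝ (⊤ : ℕ∞) fun x => (b x : ℂ) :=
    Complex.ofRealCLM.contDiff.comp b.contDiff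
  have hcs : HasCompactSupport fun x => (b x : ℂ) :=
    b.hasCompactSupport.comp_left (g := ((↑) : ℝ → ℂ)) Complex.ofReal_zero
  refine ⟨hcs.toSchwartzMap hsm, fun x hx => ?_, fun x hx => ?_⟩
  · change (b x : ℂ) = 1
    rw [b.one_of_mem_closedBall (by rwa [mem_closedBall_iff_norm]), Complex.ofReal_one]
  · change (b x : ℂ) = 0
    rw [b.zero_of_le_dist (by rwa [dist_eq_norm]), Complex.ofReal_zero]

theorem exists_decay_int_add (g : 𝓢(ℝ, ℂ)) (N : ℕ) :
    ∃ C : ℝ, 0 ≤ C ∧ ∀ n : ℤ, ∀ θ ∈ Set.Icc (0 : ℝ) 1,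
      ‖g (n + θ)‖ ≤ C * ((1 + |(n : ℝ)|) ^ N)⁻¹ := by
  refine ⟨2 ^ N * (2 ^ N * (Finset.Iic (N, 0)).sup (fun m => SchwartzMap.seminorm ℂ m.1 m.2) g),
    by positivity, fun n θ hθ => ?_⟩
  have h1 := SchwartzMap.one_add_le_sup_seminorm_apply (𝕜 := ℂ) (m := (N, 0)) le_rfl le_rfl g (n + θ)
  rw [norm_iteratedFDeriv_zero, Real.norm_eq_abs] at h1
  have h2 : 1 + |(n : ℝ)| ≤ 2 * (1 + |n + θ|) := by
    have h3 : |(n : ℝ)| ≤ |n + θ| + |θ| := by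
      simpa using abs_sub (n + θ : ℝ) θ
    rw [abs_of_nonneg hθ.1] at h3
    linarith [hθ.2, abs_nonneg (n + θ : ℝ)]
  rw [← div_eq_mul_inv, le_div_iff₀' (by positivity)]
  calc (1 + |(n : ℝ)|) ^ N * ‖g (n + θ)‖ ≤ (2 * (1 + |n + θ|)) ^ N * ‖g (n + θ)‖ := by gcongr
    _ = 2 ^ N * ((1 + |n + θ|) ^ N * ‖g (n + θ)‖) := by rw [mul_pow]; ring
    _ ≤ _ := by gcongr

theorem summable_one_add_abs_int_inv_sq : Summable fun n : ℤ => ((1 + |(n : ℝ)|) ^ 2)⁻¹ := by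
  have h : Summable fun n : ℕ => ((1 + (n : ℝ)) ^ 2)⁻¹ := by
    have := (summable_nat_add_iff 1).2 (Real.summable_nat_pow_inv.2 one_lt_two)
    refine this.congr fun n => ?_
    push_cast; rw [add_comm]
  refine Summable.of_nat_of_neg ?_ ?_
  · simpa using h
  · simpa using h

theorem summable_norm_mul_one_add_abs_pow (g : 𝓢(ℝ, ℂ)) (N : ℕ) {θ : ℝ}
    (hθ : θ ∈ Set.Icc (0 : ℝ) 1) (a : ℝ) (ha : 0 ≤ a) :
    Summable fun n : ℤ => ‖g (n + θ)‖ * (1 + |n + θ| * a) ^ N := by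
  obtain ⟨C, hC0, hC⟩ := exists_decay_int_add g (N + 2)
  refine Summable.of_nonneg_of_le (fun n => by positivity) (fun n => ?_)
    (summable_one_add_abs_int_inv_sq.mul_left (C * (2 + a) ^ N))
  have h1 : 1 + |n + θ| * a ≤ (2 + a) * (1 + |(n : ℝ)|) := by
    have := abs_add_le (n : ℝ) θ
    rw [abs_of_nonneg hθ.1] at this
    nlinarith [hθ.2, abs_nonneg (n : ℝ)]
  calc ‖g (n + θ)‖ * (1 + |n + θ| * a) ^ N
      ≤ C * ((1 + |(n : ℝ)|) ^ (N + 2))⁻¹ * ((2 + a) * (1 + |(n : ℝ)|)) ^ N := by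
        gcongr; exact hC n θ hθ
    _ = _ := by
        have : 1 + |(n : ℝ)| ≠ 0 := by positivity
        rw [mul_pow, pow_add]; field_simp

/-- Poisson summation for a modulation of `ζ`. For `|u| ≤ 1 / 4` and `n ≠ 0` one has `|u + n| ≥ 3 /
4`, outside the support of `ζ`, so the periodization reduces to its term `n = 0`. -/
theorem hasSum_sampling {ζ : 𝓢(ℝ, ℂ)} (h1 : ∀ u, |u| ≤ 1 / 4 → ζ u = 1)
    (h0 : ∀ u, 3 / 8 ≤ |u| → ζ u = 0) {θ : ℝ} (hθ : θ ∈ Set.Icc (0 : ℝ) 1) {u : ℝ}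
    (hu : |u| ≤ 1 / 4) :
    HasSum (fun n : ℤ => 𝓕 ζ (n + θ) * Complex.exp (↑(2 * Real.pi * ((n + θ) * u)) * Complex.I))
      1 := by
  have hsum : Summable fun n : ℤ =>
      𝓕 ζ (n + θ) * Complex.exp (↑(2 * Real.pi * ((n + θ) * u)) * Complex.I) := by
    refine .of_norm ?_
    have := summable_norm_mul_one_add_abs_pow (𝓕 ζ) 0 hθ 0 le_rfl
    refine this.congr fun n => ?_
    rw [norm_mul, Complex.norm_exp_ofReal_mul_I, pow_zero]
  have hP := SchwartzMap.tsum_eq_tsum_fourier (modulate (-θ) ζ) u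
  rw [tsum_eq_single 0] at hP
  swap
  · intro n hn
    rw [modulate_apply, h0, mul_zero]
    have h2 : (1 : ℝ) ≤ |(n : ℝ)| := by exact_mod_cast Int.one_le_abs hn
    have h3 : |(n : ℝ)| ≤ |u + n| + |u| := by simpa using abs_sub (u + n : ℝ) u
    linarith
  rw [Int.cast_zero, add_zero, modulate_apply, h1 u hu, mul_one] at hP
  convert hsum.hasSum
  have e : ∀ n : ℤ, 𝓕 ζ (n + θ) * Complex.exp (↑(2 * Real.pi * ((n + θ) * u)) * Complex.I) =
      Complex.exp (↑(2 * Real.pi * (θ * u)) * Complex.I) *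
        (𝓕 (modulate (-θ) ζ) n * fourier n (u : UnitAddCircle)) := by
    intro n
    rw [fourier_modulate, SchwartzMap.compSubConstCLM_apply, sub_neg_eq_add, fourier_coe_apply,
      mul_left_comm (Complex.exp _), ← Complex.exp_add]
    congr 2
    push_cast
    ring
  simp_rw [e, tsum_mul_left, ← hP, ← Complex.exp_add]
  rw [eq_comm, Complex.exp_eq_one_iff]
  refine ⟨0, ?_⟩
  simp
  ring

variable {E : Type*} [NormedAddCommGroup E] [InnerProductSpace ℝ E] [FiniteDimensional ℝ E]
  [MeasurableSpace E] [BorelSpace E]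

/-- Where `m` is nonzero the characters sum to 1 by `hasSum_sampling`. Convergence is needed in the
Schwartz topology, not just pointwise, because a tempered distribution is then applied termwise. -/
theorem hasSum_fourier_sampling {ζ : 𝓢(ℝ, ℂ)} (h1 : ∀ u, |u| ≤ 1 / 4 → ζ u = 1)
    (h0 : ∀ u, 3 / 8 ≤ |u| → ζ u = 0) {θ : ℝ} (hθ : θ ∈ Set.Icc (0 : ℝ) 1)
    (m : 𝓢(E, ℂ)) (v : E) (hm : ∀ ξ, m ξ ≠ 0 → |inner ℝ v ξ| ≤ 1 / 4) :
    HasSum (fun n : ℤ => 𝓕 ζ (n + θ) • SchwartzMap.compSubConstCLM ℂ (((n : ℝ) + θ) • v) (𝓕 m))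
      (𝓕 m) := by
  have key : HasSum (fun n : ℤ => 𝓕 ζ (n + θ) • modulate (((n : ℝ) + θ) • v) m) m := by
    refine hasSum_schwartz (fun k l => ?_) (fun ξ => ?_)
    · obtain ⟨C, N, hC⟩ := continuous_seminorm_compSubConst_le (𝓕 m)
        ((schwartzSeminormFamily ℂ E ℂ (k, l)).comp
          (FourierTransform.fourierInvCLM ℂ 𝓢(E, ℂ)).toLinearMap)
        (((schwartz_withSeminorms ℂ E ℂ).continuous_seminorm (k, l)).comp
          (FourierTransform.fourierInvCLM ℂ 𝓢(E, ℂ)).continuous)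
      refine Summable.of_nonneg_of_le (fun n => apply_nonneg _ _) (fun n => ?_)
        ((summable_norm_mul_one_add_abs_pow (𝓕 ζ) N hθ ‖v‖ (norm_nonneg v)).mul_left C)
      rw [map_smul_eq_mul, mul_left_comm]
      gcongr
      refine (hC (((n : ℝ) + θ) • v)).trans_eq ?_
      rw [norm_smul, Real.norm_eq_abs]
    · by_cases hξ : m ξ = 0
      · simp [modulate_apply, hξ, hasSum_zero]
      · have := (hasSum_sampling h1 h0 hθ (hm ξ hξ)).mul_right (m ξ)
        rw [one_mul] at this
        refine this.congr_fun fun n => ?_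
        simp [modulate_apply, inner_smul_left, mul_assoc]
  have := (FourierTransform.fourierCLM ℂ 𝓢(E, ℂ)).hasSum key
  simpa [fourier_modulate, FourierTransform.fourier_smul] using this

theorem hasSum_freqPiece_sampling {ζ : 𝓢(ℝ, ℂ)} (h1 : ∀ u, |u| ≤ 1 / 4 → ζ u = 1)
    (h0 : ∀ u, 3 / 8 ≤ |u| → ζ u = 0) {θ : ℝ} (hθ : θ ∈ Set.Icc (0 : ℝ) 1)
    (m : 𝓢(E, ℂ)) (v : E) (hm : ∀ ξ, m ((2 * Real.pi) • ξ) ≠ 0 → |inner ℝ v ξ| ≤ 1 / 4)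
    (f : 𝓢'(E, ℂ)) (x : E) :
    HasSum (fun n : ℤ => 𝓕 ζ (n + θ) * freqPiece m f (x + ((n : ℝ) + θ) • v))
      (freqPiece m f x) := by
  have h := hasSum_fourier_sampling h1 h0 hθ (dilate twoPi m) v fun ξ hξ => hm ξ hξ
  have h2 := ((SchwartzMap.compSubConstCLM ℂ x).hasSum h).map f (map_continuous f)
  refine h2.congr_fun fun n => ?_
  simp only [map_smul, smul_eq_mul, SchwartzMap.compSubConstCLM_comp, Function.comp]
  rw [add_comm x]
  rfl

theorem ENNReal_tsum_rpow_le {ι : Type*} {r : ℝ} (hr0 : 0 < r) (hr : r ≤ 1) (a : ι → ℝ≥0∞) :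
    (∑' i, a i) ^ r ≤ ∑' i, a i ^ r := by
  rw [ENNReal.tsum_eq_iSup_sum, ENNReal_iSup_rpow hr0]
  refine iSup_le fun s => le_trans ?_ (ENNReal.sum_le_tsum s)
  classical
  induction s using Finset.induction_on with
  | empty => simp [hr0]
  | insert i s hi ih =>
    rw [Finset.sum_insert hi, Finset.sum_insert hi]
    exact (ENNReal.rpow_add_le_add_rpow _ _ hr0.le hr).trans (by gcongr)

/-- There are summable weights, depending on `r` only, for which the `r`-th power of a function
with frequencies in `|⟨v, ξ⟩| ≤ 1 / 4` satisfies a sampling bound in direction `v`. -/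
theorem exists_sampling_weights {r : ℝ} (hr0 : 0 < r) (hr : r ≤ 1) :
    ∃ κ : ℤ → ℝ≥0∞, ∑' n, κ n ≠ ∞ ∧ ∀ {E : Type} [NormedAddCommGroup E] [InnerProductSpace ℝ E]
      [FiniteDimensional ℝ E] [MeasurableSpace E] [BorelSpace E] (m : 𝓢(E, ℂ)) (v : E)
      (_ : ∀ ξ, m ((2 * Real.pi) • ξ) ≠ 0 → |inner ℝ v ξ| ≤ 1 / 4) (f : 𝓢'(E, ℂ)) (x : E),
      ∀ θ ∈ Set.Icc (0 : ℝ) 1,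
        ‖freqPiece m f x‖ₑ ^ r ≤ ∑' n : ℤ, κ n * ‖freqPiece m f (x + ((n : ℝ) + θ) • v)‖ₑ ^ r := by
  obtain ⟨ζ, h1, h0⟩ := exists_schwartz_bump (0 : ℝ) (r := 1 / 4) (R := 3 / 8) (by norm_num)
    (by norm_num)
  simp only [sub_zero, Real.norm_eq_abs] at h1 h0
  -- With `N r ≥ 2` the `r`-th powers of the coefficients are still dominated by `(1 + |n|) ^ (-2)`.
  obtain ⟨N, hN⟩ := exists_nat_ge (2 / r)
  obtain ⟨C, hC0, hC⟩ := exists_decay_int_add (𝓕 ζ) N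
  refine ⟨fun n => ENNReal.ofReal (C * ((1 + |(n : ℝ)|) ^ N)⁻¹) ^ r, ?_, ?_⟩
  · have hs := (summable_one_add_abs_int_inv_sq.mul_left (C ^ r)).tsum_ofReal_ne_top
    refine ne_top_of_le_ne_top hs (ENNReal.tsum_le_tsum fun n => ?_)
    rw [ENNReal.ofReal_rpow_of_nonneg (by positivity) hr0.le]
    refine ENNReal.ofReal_le_ofReal ?_
    rw [Real.mul_rpow hC0 (by positivity), Real.inv_rpow (by positivity)]
    gcongr
    rw [← Real.rpow_natCast, ← Real.rpow_natCast, ← Real.rpow_mul (by positivity)]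
    refine Real.rpow_le_rpow_of_exponent_le (by linarith [abs_nonneg (n : ℝ)]) ?_
    rw [div_le_iff₀ hr0] at hN
    exact_mod_cast hN
  · intro E _ _ _ _ _ m v hm f x θ hθ
    have h := hasSum_freqPiece_sampling h1 h0 hθ m v hm f x
    rw [← h.tsum_eq]
    refine (ENNReal.rpow_le_rpow enorm_tsum_le_tsum_enorm hr0.le).trans ?_
    refine (ENNReal_tsum_rpow_le hr0 hr _).trans (ENNReal.tsum_le_tsum fun n => ?_)
    rw [enorm_mul, ENNReal.mul_rpow_of_nonneg _ _ hr0.le]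
    refine mul_le_mul_left (ENNReal.rpow_le_rpow ?_ hr0.le) _
    rw [← ofReal_norm]
    exact ENNReal.ofReal_le_ofReal (hC n θ hθ)

end Sampling

/-! ### Sequence norms -/

section SequenceNorms

variable {ι : Type*} {q : ℝ≥0∞}

theorem lqNorm_ofReal {r : ℝ} (hr : 0 < r) (a : ι → ℝ≥0∞) :
    lqNorm (ENNReal.ofReal r) a = (∑' k, a k ^ r) ^ (1 / r) := by
  rw [lqNorm, if_neg ENNReal.ofReal_ne_top, ENNReal.toReal_ofReal hr.le]

theorem le_lqNorm (hq : 0 < q) (a : ι → ℝ≥0∞) (k : ι) : a k ≤ lqNorm q a := by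
  rw [lqNorm]
  split_ifs with h
  · exact le_iSup a k
  · have hq' : 0 < q.toReal := ENNReal.toReal_pos hq.ne' h
    rw [one_div, ENNReal.le_rpow_inv_iff hq']
    exact ENNReal.le_tsum k

theorem lqNorm_anti {q₀ : ℝ≥0∞} (hq₀ : 0 < q₀) (h : q₀ ≤ q) (a : ι → ℝ≥0∞) :
    lqNorm q a ≤ lqNorm q₀ a := by
  by_cases hq : q = ∞
  · rw [lqNorm, if_pos hq]
    exact iSup_le (le_lqNorm hq₀ a)
  have hq₀t : q₀ ≠ ∞ := ne_top_of_le_ne_top hq h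
  have h1 : 0 < q₀.toReal := ENNReal.toReal_pos hq₀.ne' hq₀t
  have h2 : q₀.toReal ≤ q.toReal := ENNReal.toReal_mono hq h
  have h3 : 0 < q.toReal := h1.trans_le h2
  rw [lqNorm, lqNorm, if_neg hq, if_neg hq₀t]
  have h4 := ENNReal_tsum_rpow_le (r := q₀.toReal / q.toReal) (by positivity)
    ((div_le_one h3).2 h2) fun k => a k ^ q.toReal
  simp only [← ENNReal.rpow_mul, mul_div_cancel₀ _ h3.ne'] at h4
  calc (∑' k, a k ^ q.toReal) ^ (1 / q.toReal)
      = ((∑' k, a k ^ q.toReal) ^ (q₀.toReal / q.toReal)) ^ (1 / q₀.toReal) := by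
        rw [← ENNReal.rpow_mul]; congr 1; field_simp
    _ ≤ _ := by gcongr

end SequenceNorms

/-! ### Jawerth type embedding for the mixed norms -/

theorem eLpNorm_eq_lpInt {α : Type*} [MeasurableSpace α] {μ : Measure α} {p : ℝ≥0∞} (hp : 0 < p)
    (hp' : p < ∞) (F : α → ℝ≥0∞) : eLpNorm F p μ = lpInt p.toReal μ F := by
  rw [eLpNorm_eq_lintegral_rpow_enorm_toReal hp.ne' hp'.ne]
  rfl

theorem LineGenerator.eq_zero (η : LineGenerator) {u : ℝ} (hu : 3 / 2 < |u|) : η.fn u = 0 := by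
  by_contra h
  have := η.tsupport_subset (subset_tsupport _ h)
  exact absurd (abs_le.2 this) (not_le.2 hu)

theorem dilate_invTwoPow_apply {E : Type*} [NormedAddCommGroup E] [NormedSpace ℝ E] (j : ℕ)
    (m : 𝓢(E, ℂ)) (x : E) : dilate (invTwoPow j) m x = m ((2 : ℝ)⁻¹ ^ j • x) := rfl

theorem LineGenerator.dyadic_eq_zero (η : LineGenerator) (j : ℕ) {u : ℝ}
    (hu : 3 / 2 * 2 ^ j < |u|) : dyadic η.fn j u = 0 := by
  have key : ∀ i ≤ j, η.fn ((2 : ℝ)⁻¹ ^ i • u) = 0 := fun i hi => by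
    refine η.eq_zero ?_
    rw [smul_eq_mul, abs_mul, abs_of_pos (by positivity), inv_pow, inv_mul_eq_div,
      lt_div_iff₀ (by positivity)]
    refine lt_of_le_of_lt ?_ hu
    gcongr
    norm_num
  cases j with
  | zero => simpa [dyadic] using key 0 le_rfl
  | succ j =>
    change dilate (invTwoPow (j + 1)) η.fn u - dilate (invTwoPow j) η.fn u = 0
    rw [dilate_invTwoPow_apply, dilate_invTwoPow_apply, key _ le_rfl, key _ (Nat.le_succ j),
      sub_zero]

variable {d : ℕ}

theorem tensorDyadic_apply (η : LineGenerator) (k : Fin d → ℕ) (x : EuclideanSpace ℝ (Fin d)) :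
    tensorDyadic η k x = ∏ i, dyadic η.fn (k i) (x i) := rfl

theorem abs_inner_single_le_of_tensorDyadic_ne_zero (η : LineGenerator) (k : Fin d → ℕ) (i : Fin d)
    (ξ : EuclideanSpace ℝ (Fin d)) (h : tensorDyadic η k ((2 * Real.pi) • ξ) ≠ 0) :
    |inner ℝ (EuclideanSpace.single i ((2 : ℝ)⁻¹ ^ k i)) ξ| ≤ 1 / 4 := by
  rw [tensorDyadic_apply] at h
  have h1 : dyadic η.fn (k i) (((2 * Real.pi) • ξ) i) ≠ 0 := fun h0 =>
    h (Finset.prod_eq_zero (Finset.mem_univ i) h0)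
  have h2 : |2 * Real.pi * ξ i| ≤ 3 / 2 * 2 ^ k i := by
    by_contra hlt
    exact h1 (η.dyadic_eq_zero _ (not_le.1 hlt))
  rw [EuclideanSpace.inner_single_left]
  simp only [conj_trivial]
  rw [abs_mul, abs_of_pos (by positivity : (0 : ℝ) < 2 * Real.pi)] at h2
  rw [abs_mul, abs_of_pos (by positivity : (0 : ℝ) < 2⁻¹ ^ k i), inv_pow, inv_mul_eq_div,
    div_le_iff₀ (by positivity)]
  -- From `2π |ξ i| ≤ (3 / 2) 2 ^ k i` the quantity is at most `3 / (4π)`, and `π > 3`.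
  nlinarith [Real.pi_gt_three, abs_nonneg (ξ i)]

theorem lpInt_euclideanSpace (p : ℝ) (F : EuclideanSpace ℝ (Fin d) → ℝ≥0∞) :
    lpInt p volume F = lpInt p volume fun z : Fin d → ℝ => F (WithLp.toLp 2 z) := by
  rw [lpInt, lpInt]
  congr 1
  exact ((EuclideanSpace.volume_preserving_symm_measurableEquiv_toLp (Fin d)).symm.lintegral_comp_emb
    (MeasurableEquiv.measurableEmbedding _) fun x => F x ^ p).symm

theorem toLp_update_add (z : Fin d → ℝ) (i : Fin d) (y c h : ℝ) :
    WithLp.toLp 2 (Function.update z i (y + c * h)) =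
      WithLp.toLp 2 (Function.update z i y) + c • EuclideanSpace.single i h := by
  ext j
  by_cases hj : j = i
  · subst hj; simp
  · simp [hj]

/-- The embedding of Jawerth type for spaces of dominating mixed smoothness. -/
theorem exists_mixedNorm_le (η : LineGenerator) {p q p₀ q₀ : ℝ≥0∞} {t t₀ : ℝ} (hp' : p < ∞)
    (hq : 0 < q) (hp₀ : 0 < p₀) (hq₀ : 0 < q₀) (hpp : p₀ ≤ p)
    (hs : t - 1 / p.toReal ≤ t₀ - 1 / p₀.toReal) (hlt : p₀ < p ∨ t < t₀) :
    ∃ C : ℝ≥0, ∀ f, mixedNorm (d := d) η t p q f ≤ C * mixedNorm η t₀ p₀ q₀ f := by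
  have hp : 0 < p := hp₀.trans_le hpp
  have hp₀' : p₀ < ∞ := hpp.trans_lt hp'
  have hp₀r : 0 < p₀.toReal := ENNReal.toReal_pos hp₀.ne' hp₀'.ne
  have hpr : 0 < p.toReal := ENNReal.toReal_pos hp.ne' hp'.ne
  -- `r ≤ 1` makes `r`-th powers subadditive, `r ≤ p₀` puts the exponents `p₀ / r` and `p / r` in
  -- the range of Minkowski's inequality, and `r ≤ q` allows the `ℓ_r` norm in place of the `ℓ_q`
  -- norm. The minimum with 1 covers `q = ∞`.
  obtain ⟨r, hr0, hr1, hrp, hrq⟩ :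
      ∃ r : ℝ, 0 < r ∧ r ≤ 1 ∧ r ≤ p₀.toReal ∧ ENNReal.ofReal r ≤ q := by
    have h1 : min q 1 ≠ ∞ := ne_top_of_le_ne_top ENNReal.one_ne_top (min_le_right _ _)
    have h2 : 0 < (min q 1).toReal := ENNReal.toReal_pos (by simp [hq.ne']) h1
    refine ⟨min p₀.toReal (min q 1).toReal, lt_min hp₀r h2, ?_, min_le_left _ _, ?_⟩
    · refine (min_le_right _ _).trans ?_
      simpa using ENNReal.toReal_mono ENNReal.one_ne_top (min_le_right q 1)
    · refine (ENNReal.ofReal_le_ofReal (min_le_right _ _)).trans ?_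
      rw [ENNReal.ofReal_toReal h1]
      exact min_le_left _ _
  obtain ⟨κ, hκ, hsamp⟩ := exists_sampling_weights hr0 hr1
  have hpp' : p₀.toReal ≤ p.toReal := ENNReal.toReal_mono hp'.ne hpp
  obtain ⟨C, hC, hmain⟩ := exists_lpInt_tsum_le_lpInt_iSup_pi (p₀ := p₀.toReal / r)
    (p := p.toReal / r) (s₀ := t₀ * r) (s := t * r) ((one_le_div hr0).2 hrp) (by gcongr)
    (by
      rw [one_div_div, one_div_div]
      have := mul_le_mul_of_nonneg_right hs hr0.le
      rw [sub_mul, sub_mul, one_div_mul_eq_div, one_div_mul_eq_div] at this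
      exact this)
    (hlt.imp (fun h => by
      have := (ENNReal.toReal_lt_toReal hp₀'.ne hp'.ne).2 h
      gcongr) fun h => by gcongr) hκ d
  refine ⟨(C ^ (1 / r)).toNNReal, fun f => ?_⟩
  rw [ENNReal.coe_toNNReal (ENNReal.rpow_ne_top_of_nonneg (by positivity) hC)]
  set w : ℝ → (Fin d → ℕ) → EuclideanSpace ℝ (Fin d) → ℝ≥0∞ := fun s k x =>
    ENNReal.ofReal ((2 : ℝ) ^ (s * ((∑ i, k i : ℕ) : ℝ))) * ‖freqPiece (tensorDyadic η k) f x‖ₑ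
    with hw
  set a : (Fin d → ℕ) → (Fin d → ℝ) → ℝ≥0∞ := fun k z =>
    ‖freqPiece (tensorDyadic η k) f (WithLp.toLp 2 z)‖ₑ ^ r with ha
  have hwa : ∀ s k z, w s k (WithLp.toLp 2 z) ^ r =
      2 ^ (s * r * ((∑ i, k i : ℕ) : ℝ)) * a k z := by
    intro s k z
    rw [hw, ha]
    simp only
    rw [ENNReal.mul_rpow_of_nonneg _ _ hr0.le, ← ENNReal.ofReal_rpow_of_pos two_pos,
      ENNReal.ofReal_ofNat, ← ENNReal.rpow_mul]
    ring_nf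
  have ham : ∀ k, Measurable (a k) := fun k =>
    (((continuous_freqPiece _ f).comp (PiLp.continuous_toLp 2 _)).enorm.measurable).pow_const r
  have hbound : ∀ k i x, SamplingBound κ ((2 : ℝ)⁻¹ ^ k i)
      (fun y => a k (Function.update x i y)) := by
    intro k i x y θ hθ
    have := hsamp (tensorDyadic η k) (EuclideanSpace.single i ((2 : ℝ)⁻¹ ^ k i))
      (abs_inner_single_le_of_tensorDyadic_ne_zero η k i) f
      (WithLp.toLp 2 (Function.update x i y)) θ hθ
    simpa only [ha, toLp_update_add] using this
  have h := hmain a ham hbound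
  have hroot : ∀ {P : ℝ} (F : EuclideanSpace ℝ (Fin d) → ℝ≥0∞),
      lpInt P volume F =
        (lpInt (P / r) volume fun z : Fin d → ℝ => F (WithLp.toLp 2 z) ^ r) ^ (1 / r) := by
    intro P F
    rw [lpInt_rpow_left hr0, ← ENNReal.rpow_mul, mul_one_div_cancel hr0.ne', ENNReal.rpow_one,
      lpInt_euclideanSpace]
  have hleft : mixedNorm η t p q f ≤ (lpInt (p.toReal / r) volume fun z =>
      ∑' k, 2 ^ (t * r * ((∑ i, k i : ℕ) : ℝ)) * a k z) ^ (1 / r) := by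
    rw [mixedNorm, eLpNorm_eq_lpInt hp hp', hroot]
    refine ENNReal.rpow_le_rpow (lpInt_mono (by positivity) fun z => ?_) (by positivity)
    refine (ENNReal.rpow_le_rpow (lqNorm_anti (by simpa using hr0) hrq _) hr0.le).trans_eq ?_
    rw [lqNorm_ofReal hr0, ← ENNReal.rpow_mul, one_div_mul_cancel hr0.ne', ENNReal.rpow_one]
    exact tsum_congr fun k => hwa t k z
  have hright : (lpInt (p₀.toReal / r) volume fun z =>
      ⨆ k, 2 ^ (t₀ * r * ((∑ i, k i : ℕ) : ℝ)) * a k z) ^ (1 / r) ≤ mixedNorm η t₀ p₀ q₀ f := by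
    rw [mixedNorm, eLpNorm_eq_lpInt hp₀ hp₀', hroot]
    refine ENNReal.rpow_le_rpow (lpInt_mono (by positivity) fun z => ?_) (by positivity)
    refine iSup_le fun k => ?_
    rw [← hwa]
    exact ENNReal.rpow_le_rpow (le_lqNorm hq₀ (fun k => w t₀ k (WithLp.toLp 2 z)) k) hr0.le
  calc mixedNorm η t p q f ≤ _ := hleft
    _ ≤ (C * _) ^ (1 / r) := ENNReal.rpow_le_rpow h (by positivity)
    _ = C ^ (1 / r) * _ := ENNReal.mul_rpow_of_nonneg _ _ (by positivity)
    _ ≤ _ := by gcongr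

theorem mixedNorm_anti (η : LineGenerator) {p q₀ q : ℝ≥0∞} (hq₀ : 0 < q₀) (h : q₀ ≤ q) (t : ℝ)
    (f : 𝓢'(EuclideanSpace ℝ (Fin d), ℂ)) : mixedNorm η t p q f ≤ mixedNorm η t p q₀ f :=
  eLpNorm_mono_enorm fun _ => lqNorm_anti hq₀ h _

/-! ### Frequency pieces of Schwartz functions -/

section SchwartzPieces

variable {E : Type*} [NormedAddCommGroup E] [InnerProductSpace ℝ E] [FiniteDimensional ℝ E]
  [MeasurableSpace E] [BorelSpace E]

theorem freqPiece_toTemperedDistributionCLM (m g : 𝓢(E, ℂ)) (x : E) :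
    freqPiece m (SchwartzMap.toTemperedDistributionCLM E ℂ volume g) x =
      ∫ ξ, modulate x (dilate twoPi m) ξ * 𝓕 g ξ := by
  rw [freqPiece, ← fourier_modulate]
  exact (SchwartzMap.toTemperedDistributionCLM_apply_apply volume g _).trans
    (SchwartzMap.integral_fourier_mul_eq _ _)

theorem freqPiece_eq_self {m g : 𝓢(E, ℂ)} (h : ∀ ξ, 𝓕 g ξ ≠ 0 → m ((2 * Real.pi) • ξ) = 1) (x : E) :
    freqPiece m (SchwartzMap.toTemperedDistributionCLM E ℂ volume g) x = g x := by
  have hg : g x = (𝓕⁻ (𝓕 g)) x := by simp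
  rw [freqPiece_toTemperedDistributionCLM, hg, SchwartzMap.fourierInv_coe, Real.fourierInv_eq']
  congr 1
  ext ξ
  by_cases hξ : 𝓕 g ξ = 0
  · simp [hξ]
  · rw [modulate_apply, dilate_apply, twoPi, Units.val_mk0, h ξ hξ, mul_one, real_inner_comm,
      smul_eq_mul]

theorem freqPiece_eq_zero {m g : 𝓢(E, ℂ)} (h : ∀ ξ, 𝓕 g ξ ≠ 0 → m ((2 * Real.pi) • ξ) = 0) (x : E) :
    freqPiece m (SchwartzMap.toTemperedDistributionCLM E ℂ volume g) x = 0 := by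
  rw [freqPiece_toTemperedDistributionCLM, ← integral_zero E ℂ]
  congr 1
  ext ξ
  by_cases hξ : 𝓕 g ξ = 0
  · simp [hξ]
  · rw [modulate_apply, dilate_apply, twoPi, Units.val_mk0, h ξ hξ, mul_zero, zero_mul]

theorem freqPiece_sum {ι : Type*} (s : Finset ι) (m : 𝓢(E, ℂ)) (g : ι → 𝓢(E, ℂ)) (x : E) :
    freqPiece m (SchwartzMap.toTemperedDistributionCLM E ℂ volume (∑ i ∈ s, g i)) x =
      ∑ i ∈ s, freqPiece m (SchwartzMap.toTemperedDistributionCLM E ℂ volume (g i)) x := by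
  classical
  induction s using Finset.induction_on with
  | empty => simp [freqPiece]
  | insert i s hi ih =>
    rw [Finset.sum_insert hi, Finset.sum_insert hi, ← ih, map_add]
    rfl

end SchwartzPieces

/-- At such `x` the dilate of `m` by `2 ^ (-i)` is 1 for `i ≥ j` and 0 for `i < j`, because `(3 / 4)
2 ^ (j - i) ≥ 3 / 2`. Consecutive differences then vanish except at `j`. Level 0 contains the origin
and needs no lower bound. -/
theorem dyadic_apply_eq_ite {E : Type*} [NormedAddCommGroup E] [NormedSpace ℝ E] {m : 𝓢(E, ℂ)}
    (h1 : ∀ x, ‖x‖ ≤ 1 → m x = 1) (h0 : ∀ x, 3 / 2 < ‖x‖ → m x = 0) {j : ℕ} {x : E}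
    (hx : ‖x‖ ≤ 2 ^ j) (hx' : j ≠ 0 → 3 / 4 * 2 ^ j < ‖x‖) (l : ℕ) :
    dyadic m l x = if l = j then 1 else 0 := by
  have key : ∀ i : ℕ, m ((2 : ℝ)⁻¹ ^ i • x) = if j ≤ i then 1 else 0 := by
    intro i
    have hn : ‖(2 : ℝ)⁻¹ ^ i • x‖ = ‖x‖ / 2 ^ i := by
      rw [norm_smul, Real.norm_of_nonneg (by positivity), inv_pow, inv_mul_eq_div]
    split_ifs with hij
    · refine h1 _ ?_
      rw [hn, div_le_one (by positivity)]
      exact hx.trans (pow_le_pow_right₀ one_le_two hij)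
    · refine h0 _ ?_
      rw [hn, lt_div_iff₀ (by positivity)]
      refine lt_of_le_of_lt ?_ (hx' (by omega))
      obtain ⟨e, rfl⟩ : ∃ e, j = i + 1 + e := ⟨j - (i + 1), by omega⟩
      have : (1 : ℝ) ≤ 2 ^ e := one_le_pow₀ one_le_two
      rw [pow_add, pow_succ]
      nlinarith [pow_pos (two_pos : (0 : ℝ) < 2) i]
  cases l with
  | zero =>
    have := key 0
    simp only [pow_zero, one_smul] at this
    rw [dyadic, this]
    congr 1
    simp [eq_comm]
  | succ l =>
    change dilate (invTwoPow (l + 1)) m x - dilate (invTwoPow l) m x = _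
    rw [dilate_invTwoPow_apply, dilate_invTwoPow_apply, key, key]
    split_ifs <;> first | omega | simp

/-! ### Functions with a single nonzero frequency piece -/

section Level

/-- The frequencies of `g` lie in a part of the `j`-th annulus close to the `i₀`-th axis. -/
def IsLevel (i₀ : Fin d) (j : ℕ) (g : 𝓢(EuclideanSpace ℝ (Fin d), ℂ)) : Prop :=
  ∀ ξ, 𝓕 g ξ ≠ 0 → ‖(2 * Real.pi) • ξ‖ ≤ 2 ^ j ∧
    (j ≠ 0 → 3 / 4 * 2 ^ j < |2 * Real.pi * ξ i₀|) ∧ ∀ i ≠ i₀, |2 * Real.pi * ξ i| ≤ 1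

variable {i₀ : Fin d} {j : ℕ} {g : 𝓢(EuclideanSpace ℝ (Fin d), ℂ)}

theorem IsLevel.freqPiece_iso (hg : IsLevel i₀ j g) (φ : IsoGenerator d) (l : ℕ)
    (x : EuclideanSpace ℝ (Fin d)) :
    freqPiece (dyadic φ.fn l)
      (SchwartzMap.toTemperedDistributionCLM (EuclideanSpace ℝ (Fin d)) ℂ volume g) x =
      if l = j then g x else 0 := by
  have key : ∀ ξ, 𝓕 g ξ ≠ 0 →
      dyadic φ.fn l ((2 * Real.pi) • ξ) = if l = j then 1 else 0 := by
    intro ξ hξ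
    obtain ⟨h1, h2, -⟩ := hg ξ hξ
    refine dyadic_apply_eq_ite φ.eq_one (fun x hx => φ.eq_zero x hx.le) h1 (fun hj => ?_) l
    exact (h2 hj).trans_le (PiLp.norm_apply_le ((2 * Real.pi) • ξ) i₀)
  split_ifs with hl
  · exact freqPiece_eq_self (fun ξ hξ => by rw [key ξ hξ, if_pos hl]) x
  · exact freqPiece_eq_zero (fun ξ hξ => by rw [key ξ hξ, if_neg hl]) x

/-- Coordinates other than `i₀` stay in `[-1, 1]`, where only the member number 0 of the dyadic
system is nonzero; the coordinate `i₀` selects the member number `j`. -/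
theorem IsLevel.freqPiece_mixed (hg : IsLevel i₀ j g) (η : LineGenerator) (k : Fin d → ℕ)
    (x : EuclideanSpace ℝ (Fin d)) :
    freqPiece (tensorDyadic η k)
      (SchwartzMap.toTemperedDistributionCLM (EuclideanSpace ℝ (Fin d)) ℂ volume g) x =
      if k = Pi.single i₀ j then g x else 0 := by
  have h1 : ∀ u : ℝ, ‖u‖ ≤ 1 → η.fn u = 1 := fun u hu => η.eq_one u (abs_le.1 hu)
  have h0 : ∀ u : ℝ, 3 / 2 < ‖u‖ → η.fn u = 0 := fun u hu => η.eq_zero hu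
  have key : ∀ ξ, 𝓕 g ξ ≠ 0 →
      tensorDyadic η k ((2 * Real.pi) • ξ) = if k = Pi.single i₀ j then 1 else 0 := by
    intro ξ hξ
    obtain ⟨hn, hlow, hoth⟩ := hg ξ hξ
    have hfac : ∀ i, dyadic η.fn (k i) (((2 * Real.pi) • ξ) i) =
        if k i = (Pi.single i₀ j : Fin d → ℕ) i then 1 else 0 := by
      intro i
      by_cases hi : i = i₀
      · subst hi
        rw [Pi.single_eq_same]
        exact dyadic_apply_eq_ite h1 h0 ((PiLp.norm_apply_le ((2 * Real.pi) • ξ) i).trans hn) hlow _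
      · rw [Pi.single_eq_of_ne hi]
        exact dyadic_apply_eq_ite h1 h0 (by simpa using hoth i hi) (fun h => absurd rfl h) _
    rw [tensorDyadic_apply, Finset.prod_congr rfl fun i _ => hfac i]
    split_ifs with hk
    · subst hk; simp
    · obtain ⟨i, hi⟩ := Function.ne_iff.1 hk
      exact Finset.prod_eq_zero (Finset.mem_univ i) (if_neg hi)
  split_ifs with hl
  · exact freqPiece_eq_self (fun ξ hξ => by rw [key ξ hξ, if_pos hl]) x
  · exact freqPiece_eq_zero (fun ξ hξ => by rw [key ξ hξ, if_neg hl]) x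

theorem lqNorm_ite_const {ι : Type*} [DecidableEq ι] {q : ℝ≥0∞} (hq : 0 < q) {s : Finset ι}
    (hs : s.Nonempty) (c : ℝ≥0∞) :
    lqNorm q (fun l => if l ∈ s then c else 0) = (s.card : ℝ≥0∞) ^ (1 / q.toReal) * c := by
  rw [lqNorm]
  split_ifs with h
  -- For `q = ∞` the conventions `∞.toReal = 0` and `1 / 0 = 0` make the factor 1, as it should be
  -- for a supremum.
  · rw [h, ENNReal.toReal_top, div_zero, ENNReal.rpow_zero, one_mul]
    refine le_antisymm (iSup_le fun l => ?_) ?_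
    · split_ifs <;> simp
    · obtain ⟨l, hl⟩ := hs
      exact le_iSup_of_le l (by rw [if_pos hl])
  · have hq' : 0 < q.toReal := ENNReal.toReal_pos hq.ne' h
    rw [tsum_eq_sum (s := s) fun l hl => by rw [if_neg hl, ENNReal.zero_rpow_of_pos hq'],
      Finset.sum_congr rfl fun l hl => by rw [if_pos hl], Finset.sum_const, nsmul_eq_mul,
      ENNReal.mul_rpow_of_nonneg _ _ (by positivity), ← ENNReal.rpow_mul,
      mul_one_div_cancel hq'.ne', ENNReal.rpow_one]

/-- Distinct levels do not interact, and all weighted blocks share the modulus `c`, so the `ℓ_q`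
norm at each point just counts levels. -/
theorem isoNorm_levels {s : Finset ℕ} (hs : s.Nonempty)
    {g : ℕ → 𝓢(EuclideanSpace ℝ (Fin d), ℂ)} (hg : ∀ l ∈ s, IsLevel i₀ l (g l)) (φ : IsoGenerator d)
    {t : ℝ} {p q : ℝ≥0∞} (hp : 0 < p) (hp' : p < ∞) (hq : 0 < q)
    {c : EuclideanSpace ℝ (Fin d) → ℝ≥0∞} (hcm : Measurable c)
    (hc : ∀ l ∈ s, ∀ x, ENNReal.ofReal ((2 : ℝ) ^ (t * l)) * ‖g l x‖ₑ = c x) :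
    isoNorm φ t p q (SchwartzMap.toTemperedDistributionCLM (EuclideanSpace ℝ (Fin d)) ℂ volume
      (∑ l ∈ s, g l)) = (s.card : ℝ≥0∞) ^ (1 / q.toReal) * lpInt p.toReal volume c := by
  have hpr : 0 < p.toReal := ENNReal.toReal_pos hp.ne' hp'.ne
  rw [isoNorm, eLpNorm_eq_lpInt hp hp', ← lpInt_const_mul hpr _ hcm]
  congr 1
  ext x
  rw [← lqNorm_ite_const hq hs]
  congr 1
  ext l
  rw [freqPiece_sum, Finset.sum_congr rfl fun i hi => (hg i hi).freqPiece_iso φ l x,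
    Finset.sum_ite_eq s l]
  split_ifs with hl
  · exact hc l hl x
  · simp

theorem mixedNorm_levels {s : Finset ℕ} (hs : s.Nonempty)
    {g : ℕ → 𝓢(EuclideanSpace ℝ (Fin d), ℂ)} (hg : ∀ l ∈ s, IsLevel i₀ l (g l)) (η : LineGenerator)
    {t : ℝ} {p q : ℝ≥0∞} (hp : 0 < p) (hp' : p < ∞) (hq : 0 < q)
    {c : EuclideanSpace ℝ (Fin d) → ℝ≥0∞} (hcm : Measurable c)
    (hc : ∀ l ∈ s, ∀ x, ENNReal.ofReal ((2 : ℝ) ^ (t * l)) * ‖g l x‖ₑ = c x) :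
    mixedNorm η t p q (SchwartzMap.toTemperedDistributionCLM (EuclideanSpace ℝ (Fin d)) ℂ volume
      (∑ l ∈ s, g l)) = (s.card : ℝ≥0∞) ^ (1 / q.toReal) * lpInt p.toReal volume c := by
  have hpr : 0 < p.toReal := ENNReal.toReal_pos hp.ne' hp'.ne
  have hinj : Function.Injective fun l : ℕ => (Pi.single i₀ l : Fin d → ℕ) :=
    fun a b h => by simpa using congrFun h i₀
  have hcard : (s.image fun l : ℕ => (Pi.single i₀ l : Fin d → ℕ)).card = s.card :=
    Finset.card_image_of_injective s hinj
  rw [mixedNorm, eLpNorm_eq_lpInt hp hp', ← lpInt_const_mul hpr _ hcm, ← hcard]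
  congr 1
  ext x
  rw [← lqNorm_ite_const hq (hs.image _)]
  congr 1
  ext k
  rw [freqPiece_sum, Finset.sum_congr rfl fun i hi => (hg i hi).freqPiece_mixed η k x]
  split_ifs with hk
  · obtain ⟨l, hl, rfl⟩ := Finset.mem_image.1 hk
    have hsum : ∑ i ∈ s, (if (Pi.single i₀ l : Fin d → ℕ) = Pi.single i₀ i then g i x else 0) =
        g l x := by
      rw [Finset.sum_eq_single l]
      · rw [if_pos rfl]
      · exact fun i _ hi => if_neg fun h => hi (hinj h).symm
      · exact fun h => absurd hl h
    have hsingle : ∑ i, (Pi.single i₀ l : Fin d → ℕ) i = l := by simp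
    rw [hsum, hsingle]
    exact hc l hl x
  · have hsum : ∑ i ∈ s, (if k = Pi.single i₀ i then g i x else 0) = 0 :=
      Finset.sum_eq_zero fun i hi => if_neg fun h => hk (Finset.mem_image.2 ⟨i, hi, h.symm⟩)
    rw [hsum, enorm_zero, mul_zero]

end Level

/-! ### Scaling of one coordinate -/

section Stretch

/-- Multiplication of the `i₀`-th coordinate by `c`. -/
def stretch (i₀ : Fin d) (c : ℝˣ) : EuclideanSpace ℝ (Fin d) ≃L[ℝ] EuclideanSpace ℝ (Fin d) :=
  ((EuclideanSpace.equiv (Fin d) ℝ).trans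
    (ContinuousLinearEquiv.piCongrRight fun i =>
      ContinuousLinearEquiv.smulLeft (if i = i₀ then c else 1))).trans
    (EuclideanSpace.equiv (Fin d) ℝ).symm

theorem stretch_apply (i₀ : Fin d) (c : ℝˣ) (x : EuclideanSpace ℝ (Fin d)) (i : Fin d) :
    stretch i₀ c x i = (if i = i₀ then (c : ℝ) else 1) * x i := by
  change ((if i = i₀ then c else 1 : ℝˣ) : ℝ) * x i = _
  split_ifs <;> simp

theorem stretch_symm_apply (i₀ : Fin d) (c : ℝˣ) (x : EuclideanSpace ℝ (Fin d)) (i : Fin d) :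
    (stretch i₀ c).symm x i = (if i = i₀ then (c : ℝ)⁻¹ else 1) * x i := by
  have h := stretch_apply i₀ c ((stretch i₀ c).symm x) i
  rw [ContinuousLinearEquiv.apply_symm_apply] at h
  rw [h]
  split_ifs <;> simp

theorem inner_stretch (i₀ : Fin d) (c : ℝˣ) (x y : EuclideanSpace ℝ (Fin d)) :
    inner ℝ (stretch i₀ c x) ((stretch i₀ c).symm y) = inner ℝ x y := by
  simp only [PiLp.inner_apply, stretch_apply, stretch_symm_apply]
  refine Finset.sum_congr rfl fun i _ => ?_
  split_ifs <;> simp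
  field_simp

theorem map_stretch_volume (i₀ : Fin d) (c : ℝˣ) :
    Measure.map (stretch i₀ c) volume = ENNReal.ofReal |(c : ℝ)⁻¹| • volume := by
  set L := ((stretch i₀ c : EuclideanSpace ℝ (Fin d) →L[ℝ] EuclideanSpace ℝ (Fin d)) :
    EuclideanSpace ℝ (Fin d) →ₗ[ℝ] EuclideanSpace ℝ (Fin d)) with hL
  have hdet : LinearMap.det L = c := by
    have h1 : L = ((EuclideanSpace.equiv (Fin d) ℝ).symm.toLinearEquiv : (Fin d → ℝ) →ₗ[ℝ] _) ∘ₗ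
        (Matrix.toLin' (Matrix.diagonal fun i : Fin d => if i = i₀ then (c : ℝ) else 1)) ∘ₗ
        ((EuclideanSpace.equiv (Fin d) ℝ).symm.toLinearEquiv.symm : _ →ₗ[ℝ] (Fin d → ℝ)) := by
      refine LinearMap.ext fun x => ?_
      ext i
      change stretch i₀ c x i = (Matrix.diagonal fun i : Fin d =>
        if i = i₀ then (c : ℝ) else 1).mulVec (fun i => x i) i
      rw [stretch_apply, Matrix.mulVec_diagonal]
    rw [h1, LinearMap.det_conj, LinearMap.det_toLin', Matrix.det_diagonal]
    simp
  have := Measure.map_linearMap_addHaar_eq_smul_addHaar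
    (volume : Measure (EuclideanSpace ℝ (Fin d))) (f := L) (by rw [hdet]; exact c.ne_zero)
  rw [hdet] at this
  exact this

theorem fourier_comp_stretch (i₀ : Fin d) (c : ℝˣ) (G : 𝓢(EuclideanSpace ℝ (Fin d), ℂ))
    (ξ : EuclideanSpace ℝ (Fin d)) :
    𝓕 (SchwartzMap.compCLMOfContinuousLinearEquiv ℂ (stretch i₀ c) G) ξ =
      |(c : ℝ)⁻¹| • 𝓕 G ((stretch i₀ c).symm ξ) := by
  rw [SchwartzMap.fourier_coe, SchwartzMap.fourier_coe, Real.fourier_eq', Real.fourier_eq']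
  have h := (stretch i₀ c).toHomeomorph.measurableEmbedding.integral_map (μ := volume)
    fun z => Complex.exp (↑(-2 * Real.pi * inner ℝ z ((stretch i₀ c).symm ξ)) * Complex.I) • G z
  simp only [ContinuousLinearEquiv.coe_toHomeomorph, inner_stretch] at h
  rw [map_stretch_volume, integral_smul_measure, ENNReal.toReal_ofReal (abs_nonneg _)] at h
  exact h.symm

theorem lpInt_comp_stretch (i₀ : Fin d) (c : ℝˣ) {p : ℝ} (hp : 0 < p)
    {F : EuclideanSpace ℝ (Fin d) → ℝ≥0∞} (hF : Measurable F) :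
    lpInt p volume (fun x => F (stretch i₀ c x)) =
      ENNReal.ofReal |(c : ℝ)⁻¹| ^ (1 / p) * lpInt p volume F := by
  have h := lintegral_map (μ := volume) (hF.pow_const p) (stretch i₀ c).continuous.measurable
  rw [map_stretch_volume, lintegral_smul_measure] at h
  rw [lpInt, ← h, smul_eq_mul, ENNReal.mul_rpow_of_nonneg _ _ (by positivity)]
  rfl

end Stretch

/-! ### Comparison of exponents -/

/-- If `a > b`, then `2 ^ ((a - b) n) A` would tend to infinity while staying below `B`. -/
theorem exponent_le_of_two_rpow_le {a b : ℝ} {A B : ℝ≥0∞} (hA : A ≠ 0) (hB : B ≠ ∞)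
    (h : ∀ n : ℕ, 2 ^ (a * n) * A ≤ 2 ^ (b * n) * B) : a ≤ b := by
  by_contra hab
  push Not at hab
  have h1 : ∀ n : ℕ, (2 ^ (a - b) : ℝ≥0∞) ^ n * A ≤ B := by
    intro n
    have h2 : (2 ^ (a - b) : ℝ≥0∞) ^ n * A = 2 ^ (-(b * n)) * (2 ^ (a * n) * A) := by
      rw [← mul_assoc, ← two_rpow_add, ← ENNReal.rpow_natCast, ← ENNReal.rpow_mul]
      ring_nf
    rw [h2]
    calc _ ≤ 2 ^ (-(b * n)) * (2 ^ (b * n) * B) := mul_le_mul_right (h n) _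
      _ = B := by rw [← mul_assoc, ← two_rpow_add]; simp
  have h3 : Filter.Tendsto (fun n : ℕ => (2 ^ (a - b) : ℝ≥0∞) ^ n) Filter.atTop (nhds ∞) :=
    ENNReal.tendsto_pow_atTop_nhds_top_iff.2
      (ENNReal.one_lt_rpow (by norm_num) (by linarith))
  have h4 := le_of_tendsto' (ENNReal.Tendsto.mul_const h3 (Or.inl ENNReal.top_ne_zero)) h1
  rw [ENNReal.top_mul hA, top_le_iff] at h4
  exact hB h4

theorem lpInt_enorm_schwartz_ne_top (G : 𝓢(EuclideanSpace ℝ (Fin d), ℂ)) {p : ℝ≥0∞} (hp : 0 < p)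
    (hp' : p < ∞) : lpInt p.toReal volume (fun x => ‖G x‖ₑ) ≠ ∞ := by
  have := (G.eLpNorm_lt_top p volume).ne
  rwa [eLpNorm_eq_lintegral_rpow_enorm_toReal hp.ne' hp'.ne] at this

theorem lpInt_enorm_schwartz_ne_zero {G : 𝓢(EuclideanSpace ℝ (Fin d), ℂ)} (hG : G ≠ 0) {p : ℝ≥0∞}
    (hp : 0 < p) (hp' : p < ∞) : lpInt p.toReal volume (fun x => ‖G x‖ₑ) ≠ 0 := by
  intro h
  have h1 : eLpNorm G p volume = 0 := by
    rw [eLpNorm_eq_lintegral_rpow_enorm_toReal hp.ne' hp'.ne]; exact h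
  rw [eLpNorm_eq_zero_iff G.continuous.aestronglyMeasurable hp.ne'] at h1
  refine hG (DFunLike.coe_injective ?_)
  exact (Continuous.ae_eq_iff_eq volume G.continuous continuous_const).1 h1

/-! ### Test functions -/

section Tests

variable (i₀ : Fin d)

/-- A nonzero Schwartz function with frequencies in a small ball. -/
theorem exists_schwartz_fourier_ball (c : EuclideanSpace ℝ (Fin d)) :
    ∃ G : 𝓢(EuclideanSpace ℝ (Fin d), ℂ), G ≠ 0 ∧
      ∀ ξ, 𝓕 G ξ ≠ 0 → ‖(2 * Real.pi) • (ξ - c)‖ ≤ 1 / 20 := by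
  -- The outer radius is chosen so that `2π / (40π) = 1 / 20`.
  obtain ⟨ζ, h1, h0⟩ := exists_schwartz_bump c (r := 1 / (80 * Real.pi)) (R := 1 / (40 * Real.pi))
    (by positivity) (by gcongr; norm_num)
  refine ⟨𝓕⁻ ζ, fun h => ?_, fun ξ hξ => ?_⟩
  · have h2 : ζ = 0 := by
      have := congrArg 𝓕 h
      simpa using this
    have := h1 c (by simp; positivity)
    simp [h2] at this
  · have h2 : ‖ξ - c‖ < 1 / (40 * Real.pi) := by
      by_contra hlt
      refine hξ ?_
      simp [h0 ξ (not_lt.1 hlt)]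
    rw [norm_smul, Real.norm_of_nonneg (by positivity)]
    rw [lt_div_iff₀ (by positivity)] at h2
    linarith

theorem abs_coord_sub_le {x y : EuclideanSpace ℝ (Fin d)} {ε : ℝ} (h : ‖x - y‖ ≤ ε) (i : Fin d) :
    |x i - y i| ≤ ε := (PiLp.norm_apply_le (x - y) i).trans h

/-- A function whose frequencies `ξ` satisfy `2πξ ≈ (17 / 20) e_{i₀}` has, after scaling the
`i₀`-th coordinate by `2 ^ n`, its frequencies at level `n`. -/
theorem isLevel_comp_stretch {G : 𝓢(EuclideanSpace ℝ (Fin d), ℂ)}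
    (hG : ∀ ξ, 𝓕 G ξ ≠ 0 →
      ‖(2 * Real.pi) • (ξ - EuclideanSpace.single i₀ (17 / 20 / (2 * Real.pi)))‖ ≤ 1 / 20)
    {c : ℝˣ} (hc : 0 < (c : ℝ)) {j : ℕ} (hcj : (c : ℝ) ≤ 2 ^ j) (hcj' : j ≠ 0 → (c : ℝ) = 2 ^ j) :
    IsLevel i₀ j (SchwartzMap.compCLMOfContinuousLinearEquiv ℂ (stretch i₀ c) G) := by
  intro ξ hξ
  rw [fourier_comp_stretch] at hξ
  have h := hG _ (right_ne_zero_of_smul hξ)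
  set ω := (stretch i₀ c).symm ξ with hω
  have hξω : ∀ i, ξ i = (if i = i₀ then (c : ℝ) else 1) * ω i := fun i => by
    rw [← stretch_apply, hω, ContinuousLinearEquiv.apply_symm_apply]
  have hpi : (0 : ℝ) < 2 * Real.pi := by positivity
  set u : EuclideanSpace ℝ (Fin d) := (2 * Real.pi) • ω with hu
  set v : EuclideanSpace ℝ (Fin d) := EuclideanSpace.single i₀ (17 / 20) with hv
  have huv : ‖u - v‖ ≤ 1 / 20 := by
    have : (2 * Real.pi) • (ω - EuclideanSpace.single i₀ (17 / 20 / (2 * Real.pi))) = u - v := by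
      rw [smul_sub, hu, hv]
      congr 1
      ext i
      by_cases hi : i = i₀
      · subst hi; simp; field_simp
      · simp [hi]
    rwa [this] at h
  -- Hence `u i₀` lies in `[4 / 5, 9 / 10]`, strictly above `3 / 4` and with room below 1 for the
  -- other coordinates.
  have h0 : |u i₀ - 17 / 20| ≤ 1 / 20 := by
    have := abs_coord_sub_le huv i₀
    simpa [hv] using this
  have hi : ∀ i ≠ i₀, |u i| ≤ 1 / 20 := fun i hi => by
    have := abs_coord_sub_le huv i
    simpa [hv, hi] using this
  have e0 : 2 * Real.pi * ξ i₀ = c * u i₀ := by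
    rw [hξω, if_pos rfl, hu, PiLp.smul_apply, smul_eq_mul]; ring
  have ei : ∀ i ≠ i₀, 2 * Real.pi * ξ i = u i := fun i hi => by
    rw [hξω, if_neg hi, hu, PiLp.smul_apply, smul_eq_mul, one_mul]
  rw [abs_le] at h0
  have h2j : (1 : ℝ) ≤ 2 ^ j := one_le_pow₀ one_le_two
  refine ⟨?_, fun hj => ?_, fun i hne => ?_⟩
  -- The axial part has norm at most `(19 / 20) 2 ^ j`, which leaves `1 / 20` for the deviation `u -
  -- v`.
  · have hsplit : (2 * Real.pi) • ξ = EuclideanSpace.single i₀ (c * u i₀ - u i₀ + 17 / 20) +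
        (u - v) := by
      ext i
      by_cases hii : i = i₀
      · subst hii; simp [hv, e0]
      · simp [hv, hii, ei i hii]
    rw [hsplit]
    refine (norm_add_le _ _).trans ?_
    rw [PiLp.norm_single, Real.norm_eq_abs]
    have hb : |c * u i₀ - u i₀ + 17 / 20| ≤ 19 / 20 * 2 ^ j := by
      rw [abs_le]
      constructor <;> nlinarith
    by_cases hj : j = 0
    · subst hj
      rw [pow_zero] at *
      nlinarith
    · nlinarith
  · rw [e0, hcj' hj, abs_of_pos (by nlinarith [pow_pos (two_pos : (0 : ℝ) < 2) j])]
    nlinarith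
  · rw [ei i hne]
    exact (hi i hne).trans (by norm_num)

/-- Modulations of a function with frequencies close to the origin. -/
theorem isLevel_modulate {G : 𝓢(EuclideanSpace ℝ (Fin d), ℂ)}
    (hG : ∀ ξ, 𝓕 G ξ ≠ 0 → ‖(2 * Real.pi) • (ξ - 0)‖ ≤ 1 / 20) (j : ℕ) (a : ℂ) :
    IsLevel i₀ j (a • modulate
      (EuclideanSpace.single i₀ (17 / 20 * 2 ^ j / (2 * Real.pi))) G) := by
  intro ξ hξ
  rw [FourierTransform.fourier_smul, fourier_modulate] at hξ
  have h := hG _ (right_ne_zero_of_mul (a := a) hξ)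
  have hpi : (0 : ℝ) < 2 * Real.pi := by positivity
  set v : EuclideanSpace ℝ (Fin d) := EuclideanSpace.single i₀ (17 / 20 * 2 ^ j) with hv
  have e : (2 * Real.pi) • (ξ - EuclideanSpace.single i₀ (17 / 20 * 2 ^ j / (2 * Real.pi)) - 0) =
      (2 * Real.pi) • ξ - v := by
    rw [sub_zero, smul_sub, hv]
    congr 1
    ext i
    by_cases hi : i = i₀
    · subst hi; simp; field_simp
    · simp [hi]
  rw [e] at h
  have h2j : (1 : ℝ) ≤ 2 ^ j := one_le_pow₀ one_le_two
  refine ⟨?_, fun _ => ?_, fun i hi => ?_⟩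
  · calc ‖(2 * Real.pi) • ξ‖ = ‖((2 * Real.pi) • ξ - v) + v‖ := by rw [sub_add_cancel]
      _ ≤ 1 / 20 + 17 / 20 * 2 ^ j := by
          refine (norm_add_le _ _).trans (add_le_add h ?_)
          rw [hv, PiLp.norm_single, Real.norm_of_nonneg (by positivity)]
      _ ≤ _ := by linarith
  · have h0 := abs_coord_sub_le h i₀
    simp only [hv, PiLp.smul_apply, smul_eq_mul, PiLp.single_apply, if_true] at h0
    rw [abs_le] at h0
    refine lt_of_lt_of_le ?_ (le_abs_self _)
    linarith
  · have h0 := abs_coord_sub_le h i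
    simp only [hv, PiLp.smul_apply, smul_eq_mul, PiLp.single_apply, if_neg hi,
      sub_zero] at h0
    linarith

end Tests

/-! ### Necessary conditions -/

section Necessary

variable {φ : IsoGenerator d} {η : LineGenerator} {p q p₀ q₀ : ℝ≥0∞} {t t₀ : ℝ}

/-- Both quasi-norms of a stretched bump consist of one block, so only the smoothness weight and the
Jacobian depend on `c` and `j`. The case `j = 0` admits every `c ≤ 1`. -/
theorem exists_stretch_bound (i₀ : Fin d) (hp : 0 < p) (hp' : p < ∞) (hq : 0 < q) (hp₀ : 0 < p₀)
    (hp₀' : p₀ < ∞) (hq₀ : 0 < q₀)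
    (h : Embeds (mixedNorm (d := d) η t₀ p₀ q₀) (isoNorm φ t p q)) :
    ∃ A B : ℝ≥0∞, A ≠ 0 ∧ B ≠ ∞ ∧ ∀ (c : ℝˣ) (j : ℕ), 0 < (c : ℝ) → (c : ℝ) ≤ 2 ^ j →
      (j ≠ 0 → (c : ℝ) = 2 ^ j) →
      ENNReal.ofReal ((2 : ℝ) ^ (t * j)) * (ENNReal.ofReal |(c : ℝ)⁻¹| ^ (1 / p.toReal) * A) ≤
        ENNReal.ofReal ((2 : ℝ) ^ (t₀ * j)) *
          (ENNReal.ofReal |(c : ℝ)⁻¹| ^ (1 / p₀.toReal) * B) := by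
  obtain ⟨-, C, hC⟩ := h
  obtain ⟨G, hG0, hG⟩ := exists_schwartz_fourier_ball
    (EuclideanSpace.single i₀ (17 / 20 / (2 * Real.pi)))
  have hGm : Measurable fun x => ‖G x‖ₑ := G.continuous.enorm.measurable
  have hpr : 0 < p.toReal := ENNReal.toReal_pos hp.ne' hp'.ne
  have hp₀r : 0 < p₀.toReal := ENNReal.toReal_pos hp₀.ne' hp₀'.ne
  refine ⟨lpInt p.toReal volume fun x => ‖G x‖ₑ, C * lpInt p₀.toReal volume fun x => ‖G x‖ₑ,
    lpInt_enorm_schwartz_ne_zero hG0 hp hp',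
    ENNReal.mul_ne_top ENNReal.coe_ne_top (lpInt_enorm_schwartz_ne_top G hp₀ hp₀'), ?_⟩
  intro c j hc hcj hcj'
  set g : ℕ → 𝓢(EuclideanSpace ℝ (Fin d), ℂ) := fun _ =>
    SchwartzMap.compCLMOfContinuousLinearEquiv ℂ (stretch i₀ c) G with hg
  have hgx : ∀ l x, g l x = G (stretch i₀ c x) := fun l x => rfl
  have hgm : ∀ s : ℝ, Measurable fun x =>
      ENNReal.ofReal ((2 : ℝ) ^ (s * j)) * ‖G (stretch i₀ c x)‖ₑ := fun s =>
    (hGm.comp (stretch i₀ c).continuous.measurable).const_mul _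
  have hlev : ∀ l ∈ ({j} : Finset ℕ), IsLevel i₀ l (g l) := fun l hl => by
    rw [Finset.mem_singleton.1 hl]
    exact isLevel_comp_stretch i₀ hG hc hcj hcj'
  have hcst : ∀ s : ℝ, ∀ l ∈ ({j} : Finset ℕ), ∀ x,
      ENNReal.ofReal ((2 : ℝ) ^ (s * l)) * ‖g l x‖ₑ =
        ENNReal.ofReal ((2 : ℝ) ^ (s * j)) * ‖G (stretch i₀ c x)‖ₑ := fun s l hl x => by
    rw [Finset.mem_singleton.1 hl, hgx j]
  have hGs : Measurable fun x => ‖G (stretch i₀ c x)‖ₑ :=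
    hGm.comp (stretch i₀ c).continuous.measurable
  have hval : ∀ {s r : ℝ}, 0 < r → lpInt r volume (fun x =>
      ENNReal.ofReal ((2 : ℝ) ^ (s * j)) * ‖G (stretch i₀ c x)‖ₑ) =
      ENNReal.ofReal ((2 : ℝ) ^ (s * j)) *
        (ENNReal.ofReal |(c : ℝ)⁻¹| ^ (1 / r) * lpInt r volume fun x => ‖G x‖ₑ) := by
    intro s r hr
    rw [lpInt_const_mul hr _ hGs, lpInt_comp_stretch i₀ c hr hGm]
  have h1 := isoNorm_levels (Finset.singleton_nonempty j) hlev φ hp hp' hq (hgm t) (hcst t)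
  have h2 := mixedNorm_levels (Finset.singleton_nonempty j) hlev η hp₀ hp₀' hq₀ (hgm t₀) (hcst t₀)
  rw [Finset.card_singleton, Nat.cast_one, ENNReal.one_rpow, one_mul, hval hpr] at h1
  rw [Finset.card_singleton, Nat.cast_one, ENNReal.one_rpow, one_mul, hval hp₀r] at h2
  have h3 := hC _ (lt_top_iff_ne_top.2 (h2 ▸ ENNReal.mul_ne_top ENNReal.ofReal_ne_top
    (ENNReal.mul_ne_top (ENNReal.rpow_ne_top_of_nonneg (by positivity) ENNReal.ofReal_ne_top)
      (lpInt_enorm_schwartz_ne_top G hp₀ hp₀'))))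
  rw [h1, h2] at h3
  refine h3.trans_eq ?_
  ring

/-- The factors `c = 2 ^ (-n)` spread the bump along one axis while its frequencies stay at level 0,
so smoothness plays no role and `2 ^ (n / p)` is compared with `2 ^ (n / p₀)`. -/
theorem le_of_embeds (i₀ : Fin d) (hp : 0 < p) (hp' : p < ∞) (hq : 0 < q) (hp₀ : 0 < p₀)
    (hp₀' : p₀ < ∞) (hq₀ : 0 < q₀)
    (h : Embeds (mixedNorm (d := d) η t₀ p₀ q₀) (isoNorm φ t p q)) : p₀ ≤ p := by
  obtain ⟨A, B, hA, hB, hAB⟩ := exists_stretch_bound i₀ hp hp' hq hp₀ hp₀' hq₀ h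
  have hpr : 0 < p.toReal := ENNReal.toReal_pos hp.ne' hp'.ne
  have hp₀r : 0 < p₀.toReal := ENNReal.toReal_pos hp₀.ne' hp₀'.ne
  have key : 1 / p.toReal ≤ 1 / p₀.toReal := by
    refine exponent_le_of_two_rpow_le hA hB fun n => ?_
    have hinv : ENNReal.ofReal |((invTwoPow n : ℝˣ) : ℝ)⁻¹| = 2 ^ (n : ℝ) := by
      rw [← ofReal_two_rpow]
      simp [invTwoPow]
    have h1 := hAB (invTwoPow n) 0 (by simp [invTwoPow])
      (by simpa [invTwoPow] using inv_le_one_of_one_le₀ (one_le_pow₀ one_le_two)) (by simp)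
    rw [hinv] at h1
    rw [← ENNReal.rpow_mul, ← ENNReal.rpow_mul, mul_comm (n : ℝ), mul_comm (n : ℝ)] at h1
    simpa using h1
  rw [one_div_le_one_div hpr hp₀r] at key
  exact (ENNReal.toReal_le_toReal hp₀'.ne hp'.ne).1 key

/-- The factor `c = 2 ^ n` moves the bump to level `n`. A single coordinate is compressed, hence `1
/ p` and not `d / p`. -/
theorem sub_one_div_le_of_embeds (i₀ : Fin d) (hp : 0 < p) (hp' : p < ∞) (hq : 0 < q)
    (hp₀ : 0 < p₀) (hp₀' : p₀ < ∞) (hq₀ : 0 < q₀)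
    (h : Embeds (mixedNorm (d := d) η t₀ p₀ q₀) (isoNorm φ t p q)) :
    t - 1 / p.toReal ≤ t₀ - 1 / p₀.toReal := by
  obtain ⟨A, B, hA, hB, hAB⟩ := exists_stretch_bound i₀ hp hp' hq hp₀ hp₀' hq₀ h
  refine exponent_le_of_two_rpow_le hA hB fun n => ?_
  have hval : (((invTwoPow n)⁻¹ : ℝˣ) : ℝ) = 2 ^ n := by simp [invTwoPow]
  have hinv : ENNReal.ofReal |(((invTwoPow n)⁻¹ : ℝˣ) : ℝ)⁻¹| = 2 ^ (-(n : ℝ)) := by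
    rw [← ofReal_two_rpow, hval, Real.rpow_neg zero_le_two, Real.rpow_natCast,
      abs_of_pos (by positivity)]
  have h1 := hAB (invTwoPow n)⁻¹ n (by rw [hval]; positivity) hval.le (fun _ => hval)
  rw [hinv, ofReal_two_rpow, ofReal_two_rpow, ← ENNReal.rpow_mul, ← ENNReal.rpow_mul, ← mul_assoc,
    ← mul_assoc, ← two_rpow_add, ← two_rpow_add] at h1
  convert h1 using 3 <;> ring

/-- Modulation keeps the modulus, so the normalized copies of `G` at all levels have the same
weighted modulus `|G|`. With `N` levels the two norms are `N ^ (1 / q)` and `N ^ (1 / q₀)` times the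
same finite number. -/
theorem index_le_of_embeds (i₀ : Fin d) (hp : 0 < p) (hp' : p < ∞) (hq : 0 < q) (hq₀ : 0 < q₀)
    (h : Embeds (mixedNorm (d := d) η t p q₀) (isoNorm φ t p q)) : q₀ ≤ q := by
  obtain ⟨-, C, hC⟩ := h
  obtain ⟨G, hG0, hG⟩ := exists_schwartz_fourier_ball (0 : EuclideanSpace ℝ (Fin d))
  have hGm : Measurable fun x => ‖G x‖ₑ := G.continuous.enorm.measurable
  set A := lpInt p.toReal volume fun x => ‖G x‖ₑ with hA
  have hA0 : A ≠ 0 := lpInt_enorm_schwartz_ne_zero hG0 hp hp'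
  have hAt : A ≠ ∞ := lpInt_enorm_schwartz_ne_top G hp hp'
  set g : ℕ → 𝓢(EuclideanSpace ℝ (Fin d), ℂ) := fun l => (((2 : ℝ) ^ (-(t * l)) : ℝ) : ℂ) •
    modulate (EuclideanSpace.single i₀ (17 / 20 * 2 ^ l / (2 * Real.pi))) G with hg
  have hcst : ∀ (l : ℕ) x, ENNReal.ofReal ((2 : ℝ) ^ (t * l)) * ‖g l x‖ₑ = ‖G x‖ₑ := by
    intro l x
    have hn : ‖g l x‖ₑ = ENNReal.ofReal ((2 : ℝ) ^ (-(t * l))) * ‖G x‖ₑ := by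
      have hpos : (0 : ℝ) < (2 : ℝ) ^ (-(t * l)) := by positivity
      rw [← ofReal_norm, ← ofReal_norm, ← ENNReal.ofReal_mul hpos.le]
      congr 1
      change ‖(((2 : ℝ) ^ (-(t * l)) : ℝ) : ℂ) * modulate _ G x‖ = _
      rw [modulate_apply, norm_mul, norm_mul, Complex.norm_exp_ofReal_mul_I, one_mul,
        Complex.norm_real, Real.norm_of_nonneg hpos.le]
    rw [hn, ofReal_two_rpow, ofReal_two_rpow, ← mul_assoc, ← two_rpow_add]
    simp
  have hbound : ∀ n : ℕ, 2 ^ (1 / q.toReal * n) * A ≤ 2 ^ (1 / q₀.toReal * n) * (C * A) := by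
    intro n
    -- Taking `2 ^ n` levels brings the comparison into the form of `exponent_le_of_two_rpow_le`.
    have hs : (Finset.range (2 ^ n)).Nonempty := by simp
    have h1 := isoNorm_levels hs (g := g) (fun l _ => isLevel_modulate i₀ hG l _) φ hp hp' hq hGm
      (fun l _ => hcst l)
    have h2 := mixedNorm_levels hs (g := g) (fun l _ => isLevel_modulate i₀ hG l _) η hp hp' hq₀ hGm
      (fun l _ => hcst l)
    have hcard : ∀ r : ℝ, ((Finset.range (2 ^ n)).card : ℝ≥0∞) ^ r = 2 ^ (r * n) := fun r => by
      rw [Finset.card_range, Nat.cast_pow, Nat.cast_ofNat, ← ENNReal.rpow_natCast,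
        ← ENNReal.rpow_mul, mul_comm]
    rw [hcard] at h1 h2
    have h3 := hC _ (lt_top_iff_ne_top.2 (h2 ▸ ENNReal.mul_ne_top (two_rpow_ne_top _) hAt))
    rw [h1, h2] at h3
    refine h3.trans_eq ?_
    ring
  have key := exponent_le_of_two_rpow_le hA0 (ENNReal.mul_ne_top ENNReal.coe_ne_top hAt) hbound
  by_contra hlt
  push Not at hlt
  have hqt : q ≠ ∞ := hlt.ne_top
  have hqr : 0 < q.toReal := ENNReal.toReal_pos hq.ne' hqt
  -- For `q₀ = ∞` the exponent `1 / q₀.toReal` is 0, its correct value, but `toReal` is not monotone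
  -- there, so this case is separate.
  rcases eq_or_ne q₀ ∞ with rfl | hq₀t
  · rw [ENNReal.toReal_top, div_zero] at key
    exact absurd key (not_le.2 (by positivity))
  · have h4 : q.toReal < q₀.toReal := (ENNReal.toReal_lt_toReal hqt hq₀t).2 hlt
    exact absurd key (not_le.2 (one_div_lt_one_div_of_lt hqr h4))

end Necessary

end MixedTL

end

/-! ### Sufficiency of the necessary conditions -/

theorem theorem3p6 (d : ℕ) (hd : 2 ≤ d)
    (φ : MixedTL.IsoGenerator d) (η : MixedTL.LineGenerator)
    (p q : ℝ≥0∞) (t : ℝ) (hp : 0 < p) (hp' : p < ∞) (hq : 0 < q)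
    (p₀ q₀ : ℝ≥0∞) (t₀ : ℝ) (hp₀ : 0 < p₀) (hp₀' : p₀ < ∞) (hq₀ : 0 < q₀)
    (h : MixedTL.Embeds (MixedTL.mixedNorm (d := d) η t₀ p₀ q₀) (MixedTL.isoNorm φ t p q)) :
    MixedTL.Embeds (MixedTL.mixedNorm (d := d) η t₀ p₀ q₀) (MixedTL.mixedNorm η t p q) := by
  have i₀ : Fin d := ⟨0, by omega⟩
  have hpp := MixedTL.le_of_embeds i₀ hp hp' hq hp₀ hp₀' hq₀ h
  have hs := MixedTL.sub_one_div_le_of_embeds i₀ hp hp' hq hp₀ hp₀' hq₀ h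
  suffices hC : ∃ C : ℝ≥0, ∀ f, MixedTL.mixedNorm (d := d) η t p q f ≤
      C * MixedTL.mixedNorm η t₀ p₀ q₀ f by
    obtain ⟨C, hC⟩ := hC
    exact ⟨fun f hf => (hC f).trans_lt (ENNReal.mul_lt_top ENNReal.coe_lt_top hf),
      C, fun f _ => hC f⟩
  by_cases hlt : p₀ < p ∨ t < t₀
  · exact MixedTL.exists_mixedNorm_le η hp' hq hp₀ hq₀ hpp hs hlt
  -- Here `p ≤ p₀` and `t₀ ≤ t`; together with the two necessary inequalities this forces equality
  -- in both parameters, and only the indices `q₀` and `q` remain to be compared.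
  · push Not at hlt
    obtain rfl : p₀ = p := le_antisymm hpp hlt.1
    obtain rfl : t₀ = t := le_antisymm hlt.2 (by linarith)
    have hqq := MixedTL.index_le_of_embeds i₀ hp hp' hq hq₀ h
    exact ⟨1, fun f => by simpa using MixedTL.mixedNorm_anti η hq₀ hqq t₀ f⟩
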